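/- Let $\mathbb{N}=\{1,2,\dots\}$, let $L\in\mathbb{N}$, $\ell_0,\ell_1,\dots,\ell_L\in\mathbb{N}$, and $d=\sum_{k=1}^L \ell_k(\ell_{k-1}+1)$. For every $A\in C(\mathbb{R},\mathbb{R})$ and $\theta=(\theta_1,\dots,\theta_d)\in\mathbb{R}^d$ let $\mathcal{N}_A^{k,\theta}=(\mathcal{N}^{k,\theta}_{A,1},\dots,\mathcal{N}^{k,\theta}_{A,\ell_k})\colon\mathbb{R}^{\ell_0}\to\mathbb{R}^{\ell_k}$, $k\in\{1,\dots,L\}$, be the realization functions of the fully-connected feedforward neural network with activation $A$ and parameters $\theta$, that is, for all $k\in\{0,\dots,L-1\}$, $x\in\mathbb{R}^{\ell_0}$, $i\in\{1,\dots,\ell_{k+1}\}$, $$\mathcal{N}^{k+1,\theta}_{A,i}(x)=\theta_{\mathbf d_k+\ell_{k+1}\ell_k+i}+\sum_{j=1}^{\ell_k}\theta_{\mathbf d_k+(i-1)\ell_k+j}\,\xi_{k,j},\qquad \mathbf d_k=\sum_{h=1}^{k}\ell_h(\ell_{h-1}+1),$$ where $\xi_{0,j}=x_j$ and $\xi_{k,j}=A(\mathcal{N}^{k,\theta}_{A,j}(x))$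 for $k\ge1$. Let $\mu$ be a finite Borel measure on $\mathbb{R}^{\ell_0}\times\mathbb{R}^{\ell_L}$ such that $\{x\in\mathbb{R}^{\ell_0}\colon \exists\, y\in\mathbb{R}^{\ell_L}\colon (x,y)\in\operatorname{supp}(\mu)\}$ is bounded. Let $H\in C^1(\mathbb{R}^{\ell_L}\times\mathbb{R}^{\ell_L}\times\mathbb{R}^d,\mathbb{R})$, $H=H(x,y,\theta)$, satisfy $\int|H(\mathcal{N}^{L,\theta}_A(x),y,\theta)|\,\mu(dx,dy)<\infty$ for all $A\in C(\mathbb{R},\mathbb{R})$, $\theta\in\mathbb{R}^d$, and set $\mathcal{L}_A(\theta)=\int H(\mathcal{N}^{L,\theta}_A(x),y,\theta)\,\mu(dx,dy)$. Assume for all $r\in(0,\infty)$, $X\in[-r,r]^{\ell_L}$, $\Theta\in[-r,r]^d$ that $$\sup_{x\in[-r,r]^{\ell_L}}\ \sup_{(u,y)\in\operatorname{supp}(\mu)}\ \sup_{\theta\in[-r,r]^d}\ \frac{\|\nabla_xH(x,y,\theta)\|+\|\nabla_\theta H(x,y,\theta)\|}{1+|H(X,y,\Theta)|}<\infty.$$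 Let $S\subseteq\mathbb{R}$ be finite, let $\mathscr{A}\in C(\mathbb{R},\mathbb{R})$ satisfy $\mathscr{A}|_{\mathbb{R}\setminus S}\in C^1(\mathbb{R}\setminus S,\mathbb{R})$, and let $\mathscr{a}\colon\mathbb{R}\to\mathbb{R}$ satisfy $\mathscr{a}(x)=\mathscr{A}'(x)$ for all $x\in\mathbb{R}\setminus S$ and $$\min_{\sigma\in\{-1,1\}}\ \sum_{s\in S}\ \limsup_{h\searrow0}|\mathscr{a}(s+\sigma h)-\mathscr{a}(s)|=0 .$$ Let $z\in\mathbb{N}_0$, let $w=z$ if $\operatorname{supp}(\mu)$ is a finite set and $w=z+1$ otherwise, and assume for all $m\in\mathbb{N}$ that $\sup_{x\in[-m,m]}\bigl(|\mathscr{a}(x)|\,w\bigr)<\infty$. For continuous $f\colon\mathbb{R}^d\to\mathbb{R}$ and $\theta\in\mathbb{R}^d$ let $(\mathcal{D}f)(\theta)$ be the set of all $v\in\mathbb{R}^d$ with $\liminf_{0\ne h\to0}\frac{f(\theta+h)-f(\theta)-\langle v,h\rangle}{\|h\|}\ge0$ (Fréchet subgradients), and let $(\mathbb{D}f)(\theta)=\bigcap_{\varepsilon>0}\overline{\bigcup_{\|\vartheta-\theta\|<\varepsilon}(\mathcal{D}f)(\vartheta)}$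 (limiting Fréchet subgradients). Then (i) $\mathcal{L}_A\in C^1(\mathbb{R}^d,\mathbb{R})$ for all $A\in C^1(\mathbb{R},\mathbb{R})$; (ii) there exists a unique $\mathcal{G}\colon\mathbb{R}^d\to\mathbb{R}^d$ such that for all $\theta\in\mathbb{R}^d$ and all sequences $(A_n)_{n\in\mathbb{N}}\subseteq C^1(\mathbb{R},\mathbb{R})$ which satisfy $\forall x\in\mathbb{R}\ \exists m\in\mathbb{N}\colon \sum_{n=m}^\infty\bigl(|\mathscr{A}(x)-A_n(x)|+|\mathscr{a}(x)-(A_n)'(x)|\bigr)=0$ and $\forall m\in\mathbb{N}\colon \sup_{n\in\mathbb{N}}\sup_{x\in[-m,m]}\bigl[(|A_n(x)|+|(A_n)'(x)|)\,w\bigr]<\infty$ it holds that $\limsup_{n\to\infty}\|(\nabla\mathcal{L}_{A_n})(\theta)-\mathcal{G}(\theta)\|=0$; (iii) $\mathcal{G}(\theta)\in(\mathbb{D}\mathcal{L}_{\mathscr{A}})(\theta)$ for all $\theta\in\mathbb{R}^d$; and (iv) $\mathcal{G}(\theta)=(\nabla\mathcal{L}_{\mathscr{A}})(\theta)$ for all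 open $U\subseteq\mathbb{R}^d$ with $\mathcal{L}_{\mathscr{A}}|_U\in C^1(U,\mathbb{R})$ and all $\theta\in U$. -/

import Mathlib

open Filter Topology MeasureTheory
open scoped ENNReal Gradient

noncomputable section

namespace DeepANN

/-- `paramDim ℓ k = ∑_{h=1}^{k} ℓ_h (ℓ_{h-1} + 1)`: the number of real parameters in the first `k`
layers of a fully-connected feedforward network with layer widths `ℓ 0, ℓ 1, …`. -/
def paramDim (ℓ : ℕ → ℕ) (k : ℕ) : ℕ :=
  ∑ h ∈ Finset.range k, ℓ (h + 1) * (ℓ h + 1)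

/-- The space `ℝ^{ℓ_k}` (Euclidean norm) in which the `k`-th layer takes its values. -/
abbrev Layer (ℓ : ℕ → ℕ) (k : ℕ) : Type := EuclideanSpace ℝ (Fin (ℓ k))

/-- The parameter space `ℝ^d` (Euclidean norm), `d = ∑_{h=1}^{L} ℓ_h (ℓ_{h-1} + 1)`. -/
abbrev Param (ℓ : ℕ → ℕ) (L : ℕ) : Type := EuclideanSpace ℝ (Fin (paramDim ℓ L))

/-- The `n`-th entry (counted from `0`) of a vector of `ℝ^d`. The value `0` for `n ≥ d` only makes
the function total: by `weightIdx_lt` and `biasIdx_lt` it is not used in layers `1, …, L`. -/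
def entry {d : ℕ} (θ : EuclideanSpace ℝ (Fin d)) (n : ℕ) : ℝ :=
  if h : n < d then θ ⟨n, h⟩ else 0

/-- Position (from `0`) of the weight from neuron `j` of layer `k` to neuron `i` of layer `k + 1`
(neurons counted from `0`). -/
def weightIdx (ℓ : ℕ → ℕ) (k i j : ℕ) : ℕ := paramDim ℓ k + (i * ℓ k + j)

/-- Position (from `0`) of the bias of neuron `i` of layer `k + 1` (neurons counted from `0`). -/
def biasIdx (ℓ : ℕ → ℕ) (k i : ℕ) : ℕ := paramDim ℓ k + (ℓ (k + 1) * ℓ k + i)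

theorem paramDim_succ_le (ℓ : ℕ → ℕ) {k L : ℕ} (hk : k < L) :
    paramDim ℓ k + ℓ (k + 1) * (ℓ k + 1) ≤ paramDim ℓ L := by
  have h : paramDim ℓ (k + 1) ≤ paramDim ℓ L :=
    Finset.sum_le_sum_of_subset (Finset.range_mono hk)
  have h' : paramDim ℓ (k + 1) = paramDim ℓ k + ℓ (k + 1) * (ℓ k + 1) :=
    Finset.sum_range_succ _ _
  omega

theorem weightIdx_lt (ℓ : ℕ → ℕ) {k L : ℕ} (hk : k < L) (i : Fin (ℓ (k + 1))) (j : Fin (ℓ k)) :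
    weightIdx ℓ k i j < paramDim ℓ L := by
  have h := paramDim_succ_le ℓ hk
  have hi := i.isLt
  have hj := j.isLt
  unfold weightIdx
  nlinarith

theorem biasIdx_lt (ℓ : ℕ → ℕ) {k L : ℕ} (hk : k < L) (i : Fin (ℓ (k + 1))) :
    biasIdx ℓ k i < paramDim ℓ L := by
  have h := paramDim_succ_le ℓ hk
  have hi := i.isLt
  unfold biasIdx
  nlinarith

/-- The realization `𝒩_A^{k,θ}(x) ∈ ℝ^{ℓ_k}` of the first `k` layers with activation `A`: layer `1`
is an affine function of the input `x`, layer `k + 1` is an affine function of the activation `A`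
applied entrywise to layer `k` (for `k ≥ 1`). Layer `0` is the input itself. -/
def realization (ℓ : ℕ → ℕ) {d : ℕ} (A : ℝ → ℝ) (θ : EuclideanSpace ℝ (Fin d)) (x : Layer ℓ 0) :
    (k : ℕ) → Layer ℓ k
  | 0 => x
  | k + 1 => WithLp.toLp 2 fun i : Fin (ℓ (k + 1)) =>
      entry θ (biasIdx ℓ k i) +
        ∑ j : Fin (ℓ k), entry θ (weightIdx ℓ k i j) *
          (if k = 0 then realization ℓ A θ x k j else A (realization ℓ A θ x k j))

/-- The integrand `(x, y) ↦ H(𝒩_A^{L,θ}(x), y, θ)` of the risk. -/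
def lossAt (ℓ : ℕ → ℕ) (L : ℕ) (H : Layer ℓ L × Layer ℓ L × Param ℓ L → ℝ) (A : ℝ → ℝ)
    (θ : Param ℓ L) (p : Layer ℓ 0 × Layer ℓ L) : ℝ :=
  H (realization ℓ A θ p.1 L, p.2, θ)

/-- The risk `ℒ_A(θ) = ∫ H(𝒩_A^{L,θ}(x), y, θ) μ(dx, dy)`. -/
def risk (ℓ : ℕ → ℕ) (L : ℕ) (H : Layer ℓ L × Layer ℓ L × Param ℓ L → ℝ)
    (μ : Measure (Layer ℓ 0 × Layer ℓ L)) (A : ℝ → ℝ) (θ : Param ℓ L) : ℝ :=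
  ∫ p, lossAt ℓ L H A θ p ∂μ

/-- The growth condition: for all `r > 0` and all `X`, `Θ` with entries in `[-r, r]`, the quotient
`(‖∇_x H(x, y, θ)‖ + ‖∇_θ H(x, y, θ)‖) / (1 + |H(X, y, Θ)|)` is bounded, over all `x`, `θ` with
entries in `[-r, r]` and all outputs `y` that occur in the support of `μ`. -/
def GradGrowth (ℓ : ℕ → ℕ) (L : ℕ) (H : Layer ℓ L × Layer ℓ L × Param ℓ L → ℝ)
    (μ : Measure (Layer ℓ 0 × Layer ℓ L)) : Prop :=
  ∀ r : ℝ, 0 < r → ∀ (X : Layer ℓ L) (Θ : Param ℓ L), (∀ i, |X i| ≤ r) → (∀ i, |Θ i| ≤ r) →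
    ∃ C : ℝ, ∀ (x : Layer ℓ L) (u : Layer ℓ 0) (y : Layer ℓ L) (θ : Param ℓ L),
      (∀ i, |x i| ≤ r) → (∀ i, |θ i| ≤ r) → (u, y) ∈ μ.support →
      (‖∇ (fun x' => H (x', y, θ)) x‖ + ‖∇ (fun θ' => H (x, y, θ')) θ‖) / (1 + |H (X, y, Θ)|) ≤ C

/-- `∑_{s ∈ S} limsup_{h ↘ 0} |a(s + σ h) - a(s)|`, as an element of `[0, ∞]`. -/
def oneSidedOsc (a : ℝ → ℝ) (S : Finset ℝ) (σ : ℝ) : ℝ≥0∞ :=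
  ∑ s ∈ S, limsup (fun h : ℝ => ‖a (s + σ * h) - a s‖ₑ) (𝓝[>] 0)

/-- `z + 𝟙_{∞}(|supp μ|)`: equal to `z` if the support of `μ` is finite and to `z + 1` if not. -/
def boundWeight {E : Type*} [TopologicalSpace E] [MeasurableSpace E] (z : ℕ) (μ : Measure E) : ℝ :=
  z + ({⊤} : Set ℕ∞).indicator (fun _ => (1 : ℝ)) μ.support.encard

/-- The approximating sequences: all `A n` are `C¹`, at every `x` the pair `(A n x, (A n)' x)`
is eventually equal to `(g x, a x)`, and `(|A n x| + |(A n)' x|) * w` is bounded in `n` and `x`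
on every interval `[-m, m]`. -/
structure IsApprox (g a : ℝ → ℝ) (w : ℝ) (A : ℕ → ℝ → ℝ) : Prop where
  contDiff : ∀ n, ContDiff ℝ 1 (A n)
  eventually_eq : ∀ x, ∃ m : ℕ,
    ∑' n : ℕ, (‖g x - A (m + n) x‖ₑ + ‖a x - deriv (A (m + n)) x‖ₑ) = 0
  bounded : ∀ m : ℕ, ∃ C : ℝ, ∀ n, ∀ x ∈ Set.Icc (-(m : ℝ)) m,
    (|A n x| + |deriv (A n) x|) * w ≤ C

/-- `G` is the limit of the gradients `∇ℒ_{A n}` for every approximating sequence `A`. -/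
def IsGenGradient (ℓ : ℕ → ℕ) (L : ℕ) (H : Layer ℓ L × Layer ℓ L × Param ℓ L → ℝ)
    (μ : Measure (Layer ℓ 0 × Layer ℓ L)) (g a : ℝ → ℝ) (w : ℝ) (G : Param ℓ L → Param ℓ L) :
    Prop :=
  ∀ (θ : Param ℓ L) (A : ℕ → ℝ → ℝ), IsApprox g a w A →
    Tendsto (fun n => ‖∇ (risk ℓ L H μ (A n)) θ - G θ‖) atTop (𝓝 0)

/-- The set of Fréchet subgradients of `f` at `x`. -/
def frechetSubgradients {n : ℕ} (f : EuclideanSpace ℝ (Fin n) → ℝ)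
    (x : EuclideanSpace ℝ (Fin n)) : Set (EuclideanSpace ℝ (Fin n)) :=
  {y | 0 ≤ liminf (fun h : EuclideanSpace ℝ (Fin n) =>
    (((f (x + h) - f x - inner ℝ y h) / ‖h‖ : ℝ) : EReal)) (𝓝[≠] 0)}

/-- The set of limiting Fréchet subgradients of `f` at `x`. -/
def limitingSubgradients {n : ℕ} (f : EuclideanSpace ℝ (Fin n) → ℝ)
    (x : EuclideanSpace ℝ (Fin n)) : Set (EuclideanSpace ℝ (Fin n)) :=
  ⋂ ε : ℝ, ⋂ _ : 0 < ε, closure (⋃ y ∈ {z | ‖x - z‖ < ε}, frechetSubgradients f y)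

end DeepANN

end

namespace DeepANN

section Entry

variable {d : ℕ}

/-- The `n`-th entry as a continuous linear functional. -/
noncomputable def entryL (d n : ℕ) : EuclideanSpace ℝ (Fin d) →L[ℝ] ℝ :=
  if h : n < d then EuclideanSpace.proj ⟨n, h⟩ else 0

@[simp] theorem entryL_apply (n : ℕ) (θ : EuclideanSpace ℝ (Fin d)) :
    entryL d n θ = entry θ n := by
  unfold entryL entry
  split_ifs <;> simp

theorem coe_entryL (n : ℕ) : ⇑(entryL d n) = fun θ => entry θ n :=
  funext (entryL_apply n)

theorem abs_entry_le (θ : EuclideanSpace ℝ (Fin d)) (n : ℕ) : |entry θ n| ≤ ‖θ‖ := by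
  unfold entry
  split_ifs
  · exact PiLp.norm_apply_le θ _
  · simp

theorem norm_entryL_le (n : ℕ) : ‖entryL d n‖ ≤ 1 :=
  ContinuousLinearMap.opNorm_le_bound _ zero_le_one fun θ => by
    simpa using abs_entry_le θ n

end Entry

/-- The output of a layer: the identity for the input layer, the activation for all others. -/
def act (A : ℝ → ℝ) (k : ℕ) (y : ℝ) : ℝ := if k = 0 then y else A y

section Network

variable {ℓ : ℕ → ℕ} {d : ℕ}

theorem realization_succ_apply (A : ℝ → ℝ) (θ : EuclideanSpace ℝ (Fin d)) (x : Layer ℓ 0) (k : ℕ)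
    (i : Fin (ℓ (k + 1))) :
    realization ℓ A θ x (k + 1) i = entry θ (biasIdx ℓ k i) +
      ∑ j : Fin (ℓ k), entry θ (weightIdx ℓ k i j) * act A k (realization ℓ A θ x k j) := by
  simp only [realization, act]

theorem continuous_act {A : ℝ → ℝ} (hA : Continuous A) (k : ℕ) : Continuous (act A k) := by
  unfold act
  split_ifs
  · exact continuous_id
  · exact hA

theorem continuous_realization {A : ℝ → ℝ} (hA : Continuous A) (k : ℕ) :
    Continuous fun q : EuclideanSpace ℝ (Fin d) × Layer ℓ 0 => realization ℓ A q.1 q.2 k := by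
  induction k with
  | zero => exact continuous_snd
  | succ k ih =>
    have hcomp : ∀ i, Continuous fun q : EuclideanSpace ℝ (Fin d) × Layer ℓ 0 =>
        realization ℓ A q.1 q.2 (k + 1) i := fun i => by
      simp only [realization_succ_apply, ← entryL_apply]
      have := continuous_act hA k
      fun_prop
    exact (PiLp.continuous_toLp 2 _).comp (continuous_pi hcomp)

theorem realization_congr_entry (A : ℝ → ℝ) {θ θ' : EuclideanSpace ℝ (Fin d)} (x : Layer ℓ 0)
    (k : ℕ) (h : ∀ n < paramDim ℓ k, entry θ n = entry θ' n) :
    realization ℓ A θ x k = realization ℓ A θ' x k := by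
  induction k with
  | zero => rfl
  | succ k ih =>
    have hle : paramDim ℓ k ≤ paramDim ℓ (k + 1) :=
      (Nat.le_add_right _ _).trans (paramDim_succ_le ℓ k.lt_succ_self)
    ext i
    simp only [realization_succ_apply, ih fun n hn => h n (hn.trans_le hle),
      h _ (biasIdx_lt ℓ k.lt_succ_self i), h _ (weightIdx_lt ℓ k.lt_succ_self i _)]

theorem realization_congr_act {A B : ℝ → ℝ} {θ : EuclideanSpace ℝ (Fin d)} {x : Layer ℓ 0}
    (k : ℕ) (h : ∀ m < k, ∀ j, A (realization ℓ A θ x m j) = B (realization ℓ A θ x m j)) :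
    realization ℓ A θ x k = realization ℓ B θ x k := by
  induction k with
  | zero => rfl
  | succ k ih =>
    have := ih fun m hm => h m (hm.trans k.lt_succ_self)
    ext i
    simp only [realization_succ_apply, ← this, act, h k k.lt_succ_self]

/-- The direction that moves all biases of layer `k + 1` by the same amount, and no parameter that
precedes these. -/
noncomputable def biasShift (ℓ : ℕ → ℕ) (d k : ℕ) : EuclideanSpace ℝ (Fin d) :=
  WithLp.toLp 2 fun n => if paramDim ℓ k + ℓ (k + 1) * ℓ k ≤ n then 1 else 0

theorem entry_add_smul_biasShift_of_lt (θ : EuclideanSpace ℝ (Fin d)) (t : ℝ) {k n : ℕ}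
    (hn : n < paramDim ℓ k + ℓ (k + 1) * ℓ k) :
    entry (θ + t • biasShift ℓ d k) n = entry θ n := by
  unfold entry biasShift
  split_ifs
  · simp [not_le.2 hn]
  · rfl

theorem entry_add_smul_biasShift_of_le (θ : EuclideanSpace ℝ (Fin d)) (t : ℝ) {k n : ℕ}
    (hn : paramDim ℓ k + ℓ (k + 1) * ℓ k ≤ n) (hd : n < d) :
    entry (θ + t • biasShift ℓ d k) n = entry θ n + t := by
  simp [entry, biasShift, hn, hd]

theorem realization_add_smul_biasShift_of_le (A : ℝ → ℝ) (θ : EuclideanSpace ℝ (Fin d))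
    (x : Layer ℓ 0) (t : ℝ) {j k : ℕ} (hj : j ≤ k) :
    realization ℓ A (θ + t • biasShift ℓ d k) x j = realization ℓ A θ x j := by
  refine realization_congr_entry A x j fun n hn => entry_add_smul_biasShift_of_lt θ t ?_
  have : paramDim ℓ j ≤ paramDim ℓ k := Finset.sum_le_sum_of_subset (Finset.range_mono hj)
  omega

theorem realization_add_smul_biasShift_succ {L : ℕ} (A : ℝ → ℝ) (θ : Param ℓ L)
    (x : Layer ℓ 0) (t : ℝ) {k : ℕ} (hk : k < L) (i : Fin (ℓ (k + 1))) :
    realization ℓ A (θ + t • biasShift ℓ _ k) x (k + 1) i =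
      realization ℓ A θ x (k + 1) i + t := by
  have hw : ∀ j : Fin (ℓ k), weightIdx ℓ k i j < paramDim ℓ k + ℓ (k + 1) * ℓ k := fun j => by
    have hi := i.isLt
    have hj := j.isLt
    unfold weightIdx
    nlinarith
  have hb : paramDim ℓ k + ℓ (k + 1) * ℓ k ≤ biasIdx ℓ k i := by
    unfold biasIdx
    omega
  rw [realization_succ_apply, realization_succ_apply,
    entry_add_smul_biasShift_of_le θ t hb (biasIdx_lt ℓ hk i),
    realization_add_smul_biasShift_of_le A θ x t le_rfl]
  simp only [entry_add_smul_biasShift_of_lt θ t (hw _)]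
  ring

/-- The formal derivative with respect to the parameters of the realization, computed by the chain
rule with the function `a` in place of the derivative of the activation `A`. -/
noncomputable def dRealization (ℓ : ℕ → ℕ) {d : ℕ} (A a : ℝ → ℝ) (θ : EuclideanSpace ℝ (Fin d))
    (x : Layer ℓ 0) : (k : ℕ) → Fin (ℓ k) → EuclideanSpace ℝ (Fin d) →L[ℝ] ℝ
  | 0 => 0
  | k + 1 => fun i => entryL d (biasIdx ℓ k i) + ∑ j : Fin (ℓ k),
      (act A k (realization ℓ A θ x k j) • entryL d (weightIdx ℓ k i j) +
        (entry θ (weightIdx ℓ k i j) * a (realization ℓ A θ x k j)) • dRealization ℓ A a θ x k j)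

theorem hasFDerivAt_realization {A a : ℝ → ℝ} {θ : EuclideanSpace ℝ (Fin d)} {x : Layer ℓ 0}
    (n : ℕ) (h : ∀ k < n, k ≠ 0 → ∀ j,
      HasDerivAt A (a (realization ℓ A θ x k j)) (realization ℓ A θ x k j)) (i : Fin (ℓ n)) :
    HasFDerivAt (fun θ' => realization ℓ A θ' x n i) (dRealization ℓ A a θ x n i) θ := by
  induction n with
  | zero => exact hasFDerivAt_const (x i) θ
  | succ k ih =>
    have ih := ih fun m hm => h m (hm.trans k.lt_succ_self)
    have hact : ∀ j, HasFDerivAt (fun θ' => act A k (realization ℓ A θ' x k j))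
        (a (realization ℓ A θ x k j) • dRealization ℓ A a θ x k j) θ := fun j => by
      rcases Nat.eq_zero_or_pos k with rfl | hk
      · simpa [act, dRealization] using ih j
      · simp only [act, hk.ne', if_false]
        exact (h k k.lt_succ_self hk.ne' j).comp_hasFDerivAt θ (ih j)
    have hentry : ∀ m, HasFDerivAt (fun θ' => entry θ' m) (entryL d m) θ := fun m => by
      simpa only [coe_entryL] using (entryL d m).hasFDerivAt (x := θ)
    simp only [realization_succ_apply]
    refine ((hentry (biasIdx ℓ k i)).add (HasFDerivAt.fun_sum (u := Finset.univ)
      fun (j : Fin (ℓ k)) _ => (hentry (weightIdx ℓ k i j)).mul (hact j))).congr_fderiv ?_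
    simp only [dRealization]
    congr 1
    refine Finset.sum_congr rfl fun j _ => ?_
    rw [smul_smul, add_comm]

theorem tendsto_realization {ι : Type*} {l : Filter ι} {As : ι → ℝ → ℝ} {A : ℝ → ℝ}
    {θs : ι → EuclideanSpace ℝ (Fin d)} {θ : EuclideanSpace ℝ (Fin d)} {xs : ι → Layer ℓ 0}
    {x : Layer ℓ 0} (n : ℕ) (hθ : Tendsto θs l (𝓝 θ)) (hx : Tendsto xs l (𝓝 x))
    (hA : ∀ k < n, ∀ j, Tendsto (fun m => act (As m) k (realization ℓ (As m) (θs m) (xs m) k j)) l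
      (𝓝 (act A k (realization ℓ A θ x k j)))) :
    Tendsto (fun m => realization ℓ (As m) (θs m) (xs m) n) l (𝓝 (realization ℓ A θ x n)) := by
  rcases n with _ | k
  · exact hx
  have hentry : ∀ m, Tendsto (fun n => entry (θs n) m) l (𝓝 (entry θ m)) := fun m => by
    simpa only [coe_entryL, Function.comp_def] using ((entryL d m).continuous.tendsto θ).comp hθ
  have hi : ∀ i, Tendsto (fun m => realization ℓ (As m) (θs m) (xs m) (k + 1) i) l
      (𝓝 (realization ℓ A θ x (k + 1) i)) := fun i => by
    simp only [realization_succ_apply]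
    exact (hentry _).add (tendsto_finsetSum _ fun j _ =>
      (hentry _).mul (hA k k.lt_succ_self j))
  exact ((PiLp.continuous_toLp 2 _).tendsto _).comp (tendsto_pi_nhds.2 hi)

theorem tendsto_dRealization {ι : Type*} {l : Filter ι} {As as : ι → ℝ → ℝ} {A a : ℝ → ℝ}
    {θs : ι → EuclideanSpace ℝ (Fin d)} {θ : EuclideanSpace ℝ (Fin d)} {xs : ι → Layer ℓ 0}
    {x : Layer ℓ 0} (n : ℕ) (hθ : Tendsto θs l (𝓝 θ))
    (hA : ∀ k < n, ∀ j, Tendsto (fun m => act (As m) k (realization ℓ (As m) (θs m) (xs m) k j)) l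
      (𝓝 (act A k (realization ℓ A θ x k j))))
    (ha : ∀ k < n, ∀ j, Tendsto (fun m => as m (realization ℓ (As m) (θs m) (xs m) k j)) l
      (𝓝 (a (realization ℓ A θ x k j)))) (i : Fin (ℓ n)) :
    Tendsto (fun m => dRealization ℓ (As m) (as m) (θs m) (xs m) n i) l
      (𝓝 (dRealization ℓ A a θ x n i)) := by
  induction n with
  | zero => exact tendsto_const_nhds
  | succ k ih =>
    have ih := ih (fun m hm => hA m (hm.trans k.lt_succ_self))
      fun m hm => ha m (hm.trans k.lt_succ_self)
    have hentry : ∀ m, Tendsto (fun n => entry (θs n) m) l (𝓝 (entry θ m)) := fun m => by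
      simpa only [coe_entryL, Function.comp_def] using ((entryL d m).continuous.tendsto θ).comp hθ
    simp only [dRealization]
    exact tendsto_const_nhds.add (tendsto_finsetSum _ fun j _ =>
      ((hA k k.lt_succ_self j).smul_const _).add
        (((hentry _).mul (ha k k.lt_succ_self j)).smul (ih j)))

theorem exists_bound_realization {ι : Type*} {As as : ι → ℝ → ℝ}
    (hb : ∀ r : ℝ, ∃ C : ℝ, ∀ i y, |y| ≤ r → |As i y| ≤ C ∧ |as i y| ≤ C) (r : ℝ) (k : ℕ) :
    ∃ C : ℝ, ∀ i (θ : EuclideanSpace ℝ (Fin d)) (x : Layer ℓ 0), ‖θ‖ ≤ r → ‖x‖ ≤ r → ∀ j,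
      |realization ℓ (As i) θ x k j| ≤ C ∧ ‖dRealization ℓ (As i) (as i) θ x k j‖ ≤ C := by
  induction k with
  | zero =>
    refine ⟨r, fun i θ x hθ hx j => ⟨(PiLp.norm_apply_le x j).trans hx, ?_⟩⟩
    simpa [dRealization] using (norm_nonneg _).trans hx
  | succ k ih =>
    obtain ⟨C, hC⟩ := ih
    obtain ⟨B, hB⟩ := hb C
    set M := max C B
    refine ⟨(r + ℓ k * (r * M)) + (1 + ℓ k * (M + r * M * M)), fun i θ x hθ hx j => ?_⟩
    have hr : 0 ≤ r := (norm_nonneg _).trans hθ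
    have hent : ∀ n, |entry θ n| ≤ r := fun n => (abs_entry_le θ n).trans hθ
    have hact : ∀ j, |act (As i) k (realization ℓ (As i) θ x k j)| ≤ M := fun j => by
      unfold act
      split_ifs
      · exact (hC i θ x hθ hx j).1.trans (le_max_left _ _)
      · exact (hB i _ (hC i θ x hθ hx j).1).1.trans (le_max_right _ _)
    have hder : ∀ j, |as i (realization ℓ (As i) θ x k j)| ≤ M := fun j =>
      (hB i _ (hC i θ x hθ hx j).1).2.trans (le_max_right _ _)
    have h1 : |realization ℓ (As i) θ x (k + 1) j| ≤ r + ℓ k * (r * M) := by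
      rw [realization_succ_apply]
      refine (abs_add_le _ _).trans (add_le_add (hent _) ?_)
      refine (Finset.abs_sum_le_sum_abs _ _).trans ?_
      refine (Finset.sum_le_card_nsmul _ _ (r * M) fun j _ => ?_).trans (by simp)
      rw [abs_mul]
      exact mul_le_mul (hent _) (hact j) (abs_nonneg _) hr
    have h2 : ‖dRealization ℓ (As i) (as i) θ x (k + 1) j‖ ≤ 1 + ℓ k * (M + r * M * M) := by
      simp only [dRealization]
      refine (norm_add_le _ _).trans (add_le_add (norm_entryL_le _) ?_)
      refine (norm_sum_le _ _).trans ?_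
      refine (Finset.sum_le_card_nsmul _ _ (M + r * M * M) fun j _ => ?_).trans (by simp [mul_add])
      have hM0 : 0 ≤ M := (abs_nonneg _).trans (hact j)
      refine (norm_add_le _ _).trans (add_le_add ?_ ?_)
      · rw [norm_smul, Real.norm_eq_abs]
        simpa using mul_le_mul (hact j) (norm_entryL_le _) (norm_nonneg _) hM0
      · rw [norm_smul, Real.norm_eq_abs, abs_mul]
        exact mul_le_mul (mul_le_mul (hent _) (hder j) (abs_nonneg _) hr)
          ((hC i θ x hθ hx j).2.trans (le_max_left _ _)) (norm_nonneg _) (mul_nonneg hr hM0)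
    have h1' : 0 ≤ r + ℓ k * (r * M) := (abs_nonneg _).trans h1
    have h2' : 0 ≤ 1 + ℓ k * (M + r * M * M) := (norm_nonneg _).trans h2
    exact ⟨by linarith, by linarith⟩

end Network

end DeepANN

namespace DeepANN

/-- A function that is differentiable near a point, except perhaps at that point, has the limit of
its derivative as derivative there. -/
theorem hasDerivAt_of_eventually_ne {f f' : ℝ → ℝ} {x : ℝ}
    (hd : ∀ᶠ y in 𝓝[≠] x, HasDerivAt f (f' y) y) (hf : ContinuousAt f x)
    (hf' : ContinuousAt f' x) : HasDerivAt f (f' x) x := by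
  have hr : HasDerivWithinAt f (f' x) (Set.Ici x) x := by
    have hd' := hd.filter_mono (nhdsWithin_mono x fun y (hy : x < y) => hy.ne')
    refine hasDerivWithinAt_Ici_of_tendsto_deriv (s := {y | HasDerivAt f (f' y) y})
      (fun y hy => hy.differentiableAt.differentiableWithinAt) hf.continuousWithinAt hd' ?_
    exact (hf'.tendsto.mono_left nhdsWithin_le_nhds).congr' (hd'.mono fun y hy => hy.deriv.symm)
  have hl : HasDerivWithinAt f (f' x) (Set.Iic x) x := by
    have hd' := hd.filter_mono (nhdsWithin_mono x fun y (hy : y < x) => hy.ne)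
    refine hasDerivWithinAt_Iic_of_tendsto_deriv (s := {y | HasDerivAt f (f' y) y})
      (fun y hy => hy.differentiableAt.differentiableWithinAt) hf.continuousWithinAt hd' ?_
    exact (hf'.tendsto.mono_left nhdsWithin_le_nhds).congr' (hd'.mono fun y hy => hy.deriv.symm)
  simpa using hl.union hr

/-- A `C¹` cutoff function together with its derivative. -/
theorem exists_cutoff : ∃ (φ φ' : ℝ → ℝ) (C : ℝ), (∀ x, HasDerivAt φ (φ' x) x) ∧ Continuous φ' ∧
    (∀ x, |φ x| ≤ 1) ∧ (∀ x, |φ' x| ≤ C) ∧ (∀ x, 1 < |x| → φ x = 0 ∧ φ' x = 0) ∧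
    (∀ x, |x| < 1 / 2 → φ x = 1 ∧ φ' x = 0) := by
  let φ : ContDiffBump (0 : ℝ) := ⟨1 / 2, 1, by norm_num, by norm_num⟩
  have hφ : ContDiff ℝ 1 φ := φ.contDiff
  have hzero : ∀ x : ℝ, 1 < |x| → φ x = 0 := fun x hx =>
    φ.zero_of_le_dist (by simpa [φ] using hx.le)
  have hone : ∀ x : ℝ, |x| < 1 / 2 → φ x = 1 := fun x hx =>
    φ.one_of_mem_closedBall (by simpa [φ] using hx.le)
  have hderiv : Continuous (deriv φ) := hφ.continuous_deriv le_rfl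
  have hzero' : ∀ x : ℝ, 1 < |x| → deriv φ x = 0 := fun x hx => by
    have : ∀ᶠ y in 𝓝 x, 1 < |y| := continuous_abs.continuousAt.eventually (lt_mem_nhds hx)
    rw [EventuallyEq.deriv_eq (f := fun _ => (0 : ℝ)) (this.mono hzero)]
    simp
  have hone' : ∀ x : ℝ, |x| < 1 / 2 → deriv φ x = 0 := fun x hx => by
    have : ∀ᶠ y in 𝓝 x, |y| < 1 / 2 := continuous_abs.continuousAt.eventually (gt_mem_nhds hx)
    rw [EventuallyEq.deriv_eq (f := fun _ => (1 : ℝ)) (this.mono hone)]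
    simp
  obtain ⟨C, hC⟩ := (isCompact_Icc (a := (-1 : ℝ)) (b := 1)).exists_bound_of_continuousOn
    hderiv.continuousOn
  refine ⟨φ, deriv φ, max C 0, fun x => (hφ.differentiable one_ne_zero x).hasDerivAt, hderiv,
    fun x => ?_, fun x => ?_, fun x hx => ⟨hzero x hx, hzero' x hx⟩,
    fun x hx => ⟨hone x hx, hone' x hx⟩⟩
  · rw [abs_of_nonneg φ.nonneg]
    exact φ.le_one
  · by_cases hx : 1 < |x|
    · simp [hzero' x hx]
    · exact (hC x (abs_le.1 (not_lt.1 hx))).trans (le_max_left _ _)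

/-- The difference between the tangent line `g s + a s (x - s)` and `g`, on the side of `s`
opposite to the sign `σ`; zero on the other side. -/
noncomputable def tangentGap (g a : ℝ → ℝ) (σ s x : ℝ) : ℝ :=
  if σ * (x - s) < 0 then g s + a s * (x - s) - g x else 0

/-- The derivative of `tangentGap`. -/
noncomputable def tangentGap' (a : ℝ → ℝ) (σ s x : ℝ) : ℝ :=
  if σ * (x - s) < 0 then a s - a x else 0

section OneSided

variable {S : Finset ℝ} {g a : ℝ → ℝ} {σ s x : ℝ}

theorem continuous_tangentGap (hg : Continuous g) (hσ : σ ≠ 0) : Continuous (tangentGap g a σ s) := by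
  unfold tangentGap
  refine Continuous.if (fun x hx => ?_) (by fun_prop) continuous_const
  have hmem : σ * (x - s) = 0 := frontier_lt_subset_eq (f := fun x => σ * (x - s)) (by fun_prop)
    continuous_const hx
  have : x = s := by
    rcases mul_eq_zero.1 hmem with h | h
    · exact absurd h hσ
    · linarith
  simp [this]

theorem hasDerivAt_tangentGap (hσ : σ ≠ 0) (hxs : x ≠ s) (hx : HasDerivAt g (a x) x) :
    HasDerivAt (tangentGap g a σ s) (tangentGap' a σ s x) x := by
  have hc : Continuous fun y => σ * (y - s) := by fun_prop
  rcases lt_or_gt_of_ne (mul_ne_zero hσ (sub_ne_zero.2 hxs)) with h | h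
  · have he : tangentGap g a σ s =ᶠ[𝓝 x] fun y => g s + a s * (y - s) - g y :=
      (hc.continuousAt.eventually (gt_mem_nhds h)).mono fun y hy => if_pos hy
    rw [tangentGap', if_pos h]
    refine HasDerivAt.congr_of_eventuallyEq ?_ he
    exact (((((hasDerivAt_id x).sub_const s).const_mul (a s)).const_add (g s)).fun_sub
      hx).congr_deriv (by simp)
  · have he : tangentGap g a σ s =ᶠ[𝓝 x] fun _ => 0 :=
      (hc.continuousAt.eventually (lt_mem_nhds h)).mono fun y hy => if_neg hy.le.not_gt
    rw [tangentGap', if_neg h.le.not_gt]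
    exact (hasDerivAt_const x (0 : ℝ)).congr_of_eventuallyEq he

theorem continuousAt_tangentGap' (hσ : σ ≠ 0) (hxs : x ≠ s) (hx : ContinuousAt a x) :
    ContinuousAt (tangentGap' a σ s) x := by
  have hc : Continuous fun y => σ * (y - s) := by fun_prop
  rcases lt_or_gt_of_ne (mul_ne_zero hσ (sub_ne_zero.2 hxs)) with h | h
  · have he : tangentGap' a σ s =ᶠ[𝓝 x] fun y => a s - a y :=
      (hc.continuousAt.eventually (gt_mem_nhds h)).mono fun y hy => if_pos hy
    exact ContinuousAt.congr (continuousAt_const.sub hx) he.symm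
  · have he : tangentGap' a σ s =ᶠ[𝓝 x] fun _ => 0 :=
      (hc.continuousAt.eventually (lt_mem_nhds h)).mono fun y hy => if_neg hy.le.not_gt
    exact ContinuousAt.congr continuousAt_const he.symm

theorem continuousAt_add_tangentGap' (hσ : σ ≠ 0)
    (hs : ContinuousWithinAt a {y | 0 < σ * (y - s)} s) :
    ContinuousAt (fun x => a x + tangentGap' a σ s x) s := by
  have hval : a s + tangentGap' a σ s s = a s := by simp [tangentGap']
  have hs' : ContinuousWithinAt a (insert s {y | 0 < σ * (y - s)}) s :=
    continuousWithinAt_insert_self.2 hs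
  have h1 : ContinuousWithinAt (fun x => a x + tangentGap' a σ s x)
      (insert s {y | 0 < σ * (y - s)}) s := by
    refine hs'.congr (fun y hy => ?_) hval
    have : ¬ σ * (y - s) < 0 := by
      rcases hy with rfl | hy
      · simp
      · exact not_lt.2 (le_of_lt hy)
    simp [tangentGap', this]
  have h2 : ContinuousWithinAt (fun x => a x + tangentGap' a σ s x) {y | σ * (y - s) < 0} s :=
    (continuousWithinAt_const (b := a s)).congr
      (fun y hy => by simp [tangentGap', (show σ * (y - s) < 0 from hy)]) hval
  have h := h1.union h2
  rwa [show insert s {y | 0 < σ * (y - s)} ∪ {y | σ * (y - s) < 0} = Set.univ from ?_,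
    continuousWithinAt_univ] at h
  ext y
  rcases lt_trichotomy (σ * (y - s)) 0 with hy | hy | hy
  · simp [hy]
  · have : y = s := by
      rcases mul_eq_zero.1 hy with h | h
      · exact absurd h hσ
      · linarith
    simp [this]
  · simp [hy]

/-- A positive lower bound, at most `1`, for the distances between the points of a finite set. -/
theorem exists_separation (S : Finset ℝ) :
    ∃ δ : ℝ, 0 < δ ∧ δ ≤ 1 ∧ ∀ s ∈ S, ∀ t ∈ S, s ≠ t → 2 * δ < |s - t| := by
  have h : ∀ᶠ δ in 𝓝[>] (0 : ℝ), ∀ s ∈ S, ∀ t ∈ S, s ≠ t → 2 * δ < |s - t| := by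
    simp only [Filter.eventually_all_finset, Filter.eventually_imp_distrib_left]
    intro s _ t _ hst
    have : Tendsto (fun δ : ℝ => 2 * δ) (𝓝[>] 0) (𝓝 (2 * 0)) :=
      (tendsto_id.const_mul 2).mono_left nhdsWithin_le_nhds
    exact this.eventually (gt_mem_nhds (by simpa using sub_ne_zero.2 hst))
  have h1 : ∀ᶠ δ in 𝓝[>] (0 : ℝ), δ ≤ 1 :=
    (eventually_le_nhds zero_lt_one).filter_mono nhdsWithin_le_nhds
  obtain ⟨δ, ⟨h0, h1⟩, h2⟩ := ((eventually_mem_nhdsWithin.and h1).and h).exists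
  exact ⟨δ, h0, h1, h2⟩

/-- The bound for `tangentGap` near `s` given by the mean value theorem. -/
theorem abs_tangentGap_le {C δ : ℝ} (hg : Continuous g)
    (hd : ∀ y, 0 < |y - s| → |y - s| < δ → HasDerivAt g (a y) y)
    (hC : ∀ y, |y - s| ≤ δ → |a y| ≤ C) (hx : |x - s| ≤ δ) :
    |tangentGap g a σ s x| ≤ 2 * C * |x - s| := by
  have hC0 : 0 ≤ C := (abs_nonneg _).trans (hC x hx)
  unfold tangentGap
  split_ifs
  · have hgs : |g x - g s| ≤ C * |x - s| := by
      rcases lt_trichotomy x s with h | rfl | h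
      · obtain ⟨c, hc, hc'⟩ := exists_hasDerivAt_eq_slope g a h hg.continuousOn fun y hy =>
          hd y (abs_pos.2 (sub_ne_zero.2 hy.2.ne)) (by
            rw [abs_of_neg (sub_neg.2 h)] at hx
            rw [abs_of_neg (sub_neg.2 hy.2)]
            linarith [hy.1])
        have hca := hC c (by
            rw [abs_of_neg (sub_neg.2 h)] at hx
            rw [abs_of_neg (sub_neg.2 hc.2)]
            linarith [hc.1])
        rw [eq_div_iff (sub_ne_zero.2 h.ne')] at hc'
        rw [abs_sub_comm, ← hc', abs_mul, abs_sub_comm s x]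
        exact mul_le_mul_of_nonneg_right hca (abs_nonneg _)
      · simp
      · obtain ⟨c, hc, hc'⟩ := exists_hasDerivAt_eq_slope g a h hg.continuousOn fun y hy =>
          hd y (abs_pos.2 (sub_ne_zero.2 hy.1.ne')) (by
            rw [abs_of_pos (sub_pos.2 h)] at hx
            rw [abs_of_pos (sub_pos.2 hy.1)]
            linarith [hy.2])
        have hca := hC c (by
            rw [abs_of_pos (sub_pos.2 h)] at hx
            rw [abs_of_pos (sub_pos.2 hc.1)]
            linarith [hc.2])
        rw [eq_div_iff (sub_ne_zero.2 h.ne')] at hc'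
        rw [← hc', abs_mul]
        exact mul_le_mul_of_nonneg_right hca (abs_nonneg _)
    have has : |a s * (x - s)| ≤ C * |x - s| := by
      rw [abs_mul]
      refine mul_le_mul_of_nonneg_right (hC s ?_) (abs_nonneg _)
      simpa using (abs_nonneg _).trans hx
    calc |g s + a s * (x - s) - g x| = |a s * (x - s) - (g x - g s)| := by congr 1; ring
      _ ≤ |a s * (x - s)| + |g x - g s| := abs_sub _ _
      _ ≤ 2 * C * |x - s| := by linarith
  · simpa using mul_nonneg (mul_nonneg zero_le_two hC0) (abs_nonneg _)

end OneSided

/-- Existence of approximating sequences: near every point of `S` the function is replaced, on the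
side on which `a` need not be continuous, by its tangent line. -/
theorem exists_isApprox {S : Finset ℝ} {g a : ℝ → ℝ} {σ w : ℝ} (hσ : σ ≠ 0) (hg : Continuous g)
    (hd : ∀ x ∉ S, HasDerivAt g (a x) x) (hc : ∀ x ∉ S, ContinuousAt a x)
    (hs : ∀ s ∈ S, ContinuousWithinAt a {y | 0 < σ * (y - s)} s) (hw : 0 ≤ w)
    (hb : w ≠ 0 → ∀ r : ℝ, ∃ C : ℝ, ∀ x, |x| ≤ r → |a x| ≤ C) :
    ∃ A : ℕ → ℝ → ℝ, IsApprox g a w A := by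
  obtain ⟨φ, φ', Cφ, hφd, hφ'c, hφ1, hφC, hφ0, hφe⟩ := exists_cutoff
  obtain ⟨δ, hδ0, hδ1, hδ⟩ := exists_separation S
  let ε : ℕ → ℝ := fun n => δ / (n + 1)
  have hε0 : ∀ n, 0 < ε n := fun n => by positivity
  have hεδ : ∀ n, ε n ≤ δ := fun n => div_le_self hδ0.le (by simp)
  have hφc : Continuous φ := continuous_iff_continuousAt.2 fun x => (hφd x).continuousAt
  have hout : ∀ n y, ε n < |y| → φ (y / ε n) = 0 ∧ φ' (y / ε n) = 0 := fun n y hy =>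
    hφ0 _ (by rwa [abs_div, abs_of_pos (hε0 n), one_lt_div (hε0 n)])
  have hin : ∀ n y, |y| < ε n / 2 → φ (y / ε n) = 1 ∧ φ' (y / ε n) = 0 := fun n y hy =>
    hφe _ (by rw [abs_div, abs_of_pos (hε0 n), div_lt_iff₀ (hε0 n)]; linarith)
  let A : ℕ → ℝ → ℝ := fun n x => g x + ∑ s ∈ S, φ ((x - s) / ε n) * tangentGap g a σ s x
  let B : ℕ → ℝ → ℝ := fun n x => a x + ∑ s ∈ S,
    (φ' ((x - s) / ε n) / ε n * tangentGap g a σ s x + φ ((x - s) / ε n) * tangentGap' a σ s x)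
  have hA : ∀ n, Continuous (A n) := fun n =>
    hg.add (continuous_finsetSum _ fun s _ =>
      (hφc.comp (by fun_prop)).mul (continuous_tangentGap hg hσ))
  have hderiv : ∀ n, ∀ x ∉ S, HasDerivAt (A n) (B n x) x := fun n x hx => by
    refine (hd x hx).fun_add (HasDerivAt.fun_sum fun s hsS => ?_)
    have hxs : x ≠ s := fun h => hx (h ▸ hsS)
    refine HasDerivAt.fun_mul ?_ (hasDerivAt_tangentGap hσ hxs (hd x hx))
    exact ((hφd _).comp x (((hasDerivAt_id x).sub_const s).div_const (ε n))).congr_deriv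
      (by rw [id, mul_one_div])
  have hBS : ∀ n, ∀ s ∈ S, B n =ᶠ[𝓝 s] fun x => a x + tangentGap' a σ s x := fun n s hsS => by
    have hnear : ∀ᶠ x in 𝓝 s, |x - s| < ε n / 2 := by
      have : ContinuousAt (fun x => |x - s|) s := by fun_prop
      exact this.eventually (gt_mem_nhds (by simpa using hε0 n))
    refine hnear.mono fun x hx => ?_
    simp only [B]
    rw [Finset.sum_eq_single_of_mem s hsS, (hin n _ hx).1, (hin n _ hx).2]
    · ring
    · intro t ht hts
      have h1 := hδ s hsS t ht hts.symm
      have h2 : |s - t| ≤ |x - s| + |x - t| := by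
        have := abs_sub_le s x t
        rwa [abs_sub_comm s x] at this
      have h3 : ε n < |x - t| := by linarith [hεδ n]
      rw [(hout n _ h3).1, (hout n _ h3).2]
      ring
  have hB : ∀ n, Continuous (B n) := fun n => continuous_iff_continuousAt.2 fun x => by
    by_cases hx : x ∈ S
    · exact (continuousAt_add_tangentGap' hσ (hs x hx)).congr (hBS n x hx).symm
    · refine (hc x hx).add (tendsto_finsetSum _ fun s hsS => ?_)
      have hxs : x ≠ s := fun h => hx (h ▸ hsS)
      have h1 : ContinuousAt (fun x => φ' ((x - s) / ε n) / ε n * tangentGap g a σ s x) x :=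
        (((hφ'c.comp (by fun_prop)).div_const _).mul (continuous_tangentGap hg hσ)).continuousAt
      have h2 : ContinuousAt (fun x => φ ((x - s) / ε n)) x :=
        (hφc.comp (by fun_prop)).continuousAt
      exact h1.add (h2.mul (continuousAt_tangentGap' hσ hxs (hc x hx)))
  have hderiv' : ∀ n x, HasDerivAt (A n) (B n x) x := fun n x => by
    refine hasDerivAt_of_eventually_ne ?_ (hA n).continuousAt (hB n).continuousAt
    have : ∀ᶠ y in 𝓝[≠] x, y ∉ S := by
      have h := (S.finite_toSet.sdiff (t := {x})).isClosed.compl_mem_nhds (x := x) (by simp)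
      filter_upwards [nhdsWithin_le_nhds h, self_mem_nhdsWithin] with y hy hyx hyS
      exact hy ⟨hyS, hyx⟩
    exact this.mono fun y hy => hderiv n y hy
  have hdB : ∀ n, deriv (A n) = B n := fun n => funext fun x => (hderiv' n x).deriv
  refine ⟨A, fun n => ?_, fun x => ?_, fun m => ?_⟩
  · exact contDiff_one_iff_deriv.2 ⟨fun x => (hderiv' n x).differentiableAt, by
      rw [hdB]; exact hB n⟩
  · have hε : Tendsto ε atTop (𝓝 0) := by
      simpa [ε, div_eq_mul_inv] using tendsto_one_div_add_atTop_nhds_zero_nat.const_mul δ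
    have hev : ∀ᶠ n in atTop, ∀ s ∈ S, x ≠ s → ε n < |x - s| := by
      simp only [Filter.eventually_all_finset, Filter.eventually_imp_distrib_left]
      exact fun s _ hxs => hε.eventually (gt_mem_nhds (abs_pos.2 (sub_ne_zero.2 hxs)))
    obtain ⟨m, hm⟩ := eventually_atTop.1 hev
    refine ⟨m, ENNReal.tsum_eq_zero.2 fun n => ?_⟩
    have hAx : A (m + n) x = g x := by
      simp only [A, add_eq_left]
      refine Finset.sum_eq_zero fun s hsS => ?_
      by_cases hxs : x = s
      · simp [tangentGap, hxs]
      · rw [(hout _ _ (hm (m + n) (Nat.le_add_right _ _) s hsS hxs)).1, zero_mul]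
    have hBx : B (m + n) x = a x := by
      simp only [B, add_eq_left]
      refine Finset.sum_eq_zero fun s hsS => ?_
      by_cases hxs : x = s
      · simp [tangentGap, tangentGap', hxs]
      · have := hout _ _ (hm (m + n) (Nat.le_add_right _ _) s hsS hxs)
        rw [this.1, this.2]
        ring
    simp [hdB, hAx, hBx]
  · rcases eq_or_ne w 0 with rfl | hw0
    · exact ⟨0, by simp⟩
    obtain ⟨R, hR⟩ : ∃ R : ℝ, (m : ℝ) ≤ R ∧ ∀ s ∈ S, |s| + 1 ≤ R := by
      obtain ⟨R, hR⟩ := (S.image fun s => |s| + 1).bddAbove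
      exact ⟨max m R, le_max_left _ _, fun s hsS =>
        (hR (Finset.mem_coe.2 (Finset.mem_image_of_mem _ hsS))).trans (le_max_right _ _)⟩
    obtain ⟨C, hC⟩ := hb hw0 R
    obtain ⟨G, hG⟩ := (isCompact_Icc (a := -(m : ℝ)) (b := m)).exists_bound_of_continuousOn
      hg.continuousOn
    have hCφ : 0 ≤ Cφ := (abs_nonneg _).trans (hφC 0)
    have hC0 : 0 ≤ C := (abs_nonneg _).trans (hC 0 (by
      simpa using (Nat.cast_nonneg m).trans hR.1))
    refine ⟨((G + ∑ s ∈ S, 2 * C) + (C + ∑ s ∈ S, (Cφ * (2 * C) + 2 * C))) * w,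
      fun n x hx => mul_le_mul_of_nonneg_right ?_ hw⟩
    have hax : |a x| ≤ C := hC x ((abs_le.2 hx).trans hR.1)
    have hgap : ∀ s ∈ S, |x - s| ≤ ε n → |tangentGap g a σ s x| ≤ 2 * C * ε n := fun s hsS hxs => by
      refine (abs_tangentGap_le (δ := δ) (C := C) hg (fun y hy0 hy1 => hd y fun hyS => ?_)
        (fun y hy => hC y ?_) (hxs.trans (hεδ n))).trans
        (mul_le_mul_of_nonneg_left hxs (by positivity))
      · have := hδ y hyS s hsS fun h => by simp [h] at hy0
        linarith
      · have h1 := abs_sub_abs_le_abs_sub y s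
        have h2 := hR.2 s hsS
        linarith
    have hgap' : ∀ s ∈ S, |tangentGap' a σ s x| ≤ 2 * C := fun s hsS => by
      have has : |a s| ≤ C := hC s (by linarith [hR.2 s hsS])
      unfold tangentGap'
      split_ifs
      · exact (abs_sub _ _).trans (by linarith)
      · simpa using hC0
    rw [hdB]
    refine add_le_add ((abs_add_le _ _).trans (add_le_add (hG x hx) ?_))
      ((abs_add_le _ _).trans (add_le_add hax ?_))
    · refine (Finset.abs_sum_le_sum_abs _ _).trans (Finset.sum_le_sum fun s hsS => ?_)
      by_cases hxs : |x - s| ≤ ε n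
      · rw [abs_mul]
        calc |φ ((x - s) / ε n)| * |tangentGap g a σ s x| ≤ 1 * (2 * C * ε n) :=
              mul_le_mul (hφ1 _) (hgap s hsS hxs) (abs_nonneg _) zero_le_one
          _ ≤ 2 * C := by nlinarith [(hεδ n).trans hδ1]
      · rw [(hout n _ (not_le.1 hxs)).1]
        simpa using hC0
    · refine (Finset.abs_sum_le_sum_abs _ _).trans (Finset.sum_le_sum fun s hsS => ?_)
      refine (abs_add_le _ _).trans (add_le_add ?_ ?_)
      · by_cases hxs : |x - s| ≤ ε n
        · rw [abs_mul, abs_div, abs_of_pos (hε0 n)]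
          calc |φ' ((x - s) / ε n)| / ε n * |tangentGap g a σ s x|
              ≤ Cφ / ε n * (2 * C * ε n) :=
                mul_le_mul (div_le_div_of_nonneg_right (hφC _) (hε0 n).le) (hgap s hsS hxs)
                  (abs_nonneg _) (div_nonneg hCφ (hε0 n).le)
            _ = Cφ * (2 * C) := by field_simp [(hε0 n).ne']
        · rw [(hout n _ (not_le.1 hxs)).2]
          simpa using mul_nonneg hCφ (mul_nonneg zero_le_two hC0)
      · rw [abs_mul]
        calc |φ ((x - s) / ε n)| * |tangentGap' a σ s x| ≤ 1 * (2 * C) :=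
              mul_le_mul (hφ1 _) (hgap' s hsS) (abs_nonneg _) zero_le_one
          _ = 2 * C := one_mul _

end DeepANN

namespace DeepANN

variable {ℓ : ℕ → ℕ} {L : ℕ} {H : Layer ℓ L × Layer ℓ L × Param ℓ L → ℝ}
  {μ : Measure (Layer ℓ 0 × Layer ℓ L)}

/-- The formal Jacobian of the output layer with respect to the parameters. -/
noncomputable def jacobian (ℓ : ℕ → ℕ) (L : ℕ) (A a : ℝ → ℝ) (θ : Param ℓ L) (x : Layer ℓ 0) :
    Param ℓ L →L[ℝ] Layer ℓ L :=
  ∑ i, (dRealization ℓ A a θ x L i).smulRight (EuclideanSpace.single i (1 : ℝ))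

/-- The formal derivative of the loss with respect to the parameters, computed with the function
`a` in place of the derivative of the activation `A`. -/
noncomputable def dLoss (ℓ : ℕ → ℕ) (L : ℕ) (H : Layer ℓ L × Layer ℓ L × Param ℓ L → ℝ)
    (A a : ℝ → ℝ) (θ : Param ℓ L) (p : Layer ℓ 0 × Layer ℓ L) : Param ℓ L →L[ℝ] ℝ :=
  (fderiv ℝ H (realization ℓ A θ p.1 L, p.2, θ)).comp
    ((jacobian ℓ L A a θ p.1).prod ((0 : Param ℓ L →L[ℝ] Layer ℓ L).prod (.id ℝ _)))

theorem jacobian_apply (A a : ℝ → ℝ) (θ : Param ℓ L) (x : Layer ℓ 0) (v : Param ℓ L)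
    (i : Fin (ℓ L)) : jacobian ℓ L A a θ x v i = dRealization ℓ A a θ x L i v := by
  simp [jacobian, Pi.single_apply]

theorem hasFDerivAt_lossAt (hH : ContDiff ℝ 1 H) {A a : ℝ → ℝ} {θ : Param ℓ L}
    {p : Layer ℓ 0 × Layer ℓ L} (h : ∀ k < L, k ≠ 0 → ∀ j,
      HasDerivAt A (a (realization ℓ A θ p.1 k j)) (realization ℓ A θ p.1 k j)) :
    HasFDerivAt (fun θ' => lossAt ℓ L H A θ' p) (dLoss ℓ L H A a θ p) θ := by
  have hN : HasFDerivAt (fun θ' => realization ℓ A θ' p.1 L) (jacobian ℓ L A a θ p.1) θ := by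
    rw [← hasFDerivWithinAt_univ]
    refine hasFDerivWithinAt_euclidean.2 fun i => ?_
    refine ((hasFDerivAt_realization L h i).congr_fderiv ?_).hasFDerivWithinAt
    ext v
    simp [jacobian_apply]
  exact ((hH.differentiable one_ne_zero _).hasFDerivAt).comp θ
    (hN.prodMk ((hasFDerivAt_const p.2 θ).prodMk (hasFDerivAt_id θ)))

theorem tendsto_dLoss (hH : ContDiff ℝ 1 H) {ι : Type*} {l : Filter ι} {As as : ι → ℝ → ℝ}
    {A a : ℝ → ℝ} {θs : ι → Param ℓ L} {θ : Param ℓ L} {ps : ι → Layer ℓ 0 × Layer ℓ L}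
    {p : Layer ℓ 0 × Layer ℓ L} (hθ : Tendsto θs l (𝓝 θ)) (hp : Tendsto ps l (𝓝 p))
    (hA : ∀ k < L, ∀ j,
      Tendsto (fun m => act (As m) k (realization ℓ (As m) (θs m) (ps m).1 k j)) l
        (𝓝 (act A k (realization ℓ A θ p.1 k j))))
    (ha : ∀ k < L, ∀ j, Tendsto (fun m => as m (realization ℓ (As m) (θs m) (ps m).1 k j)) l
      (𝓝 (a (realization ℓ A θ p.1 k j)))) :
    Tendsto (fun m => dLoss ℓ L H (As m) (as m) (θs m) (ps m)) l (𝓝 (dLoss ℓ L H A a θ p)) := by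
  have hx : Tendsto (fun m => (ps m).1) l (𝓝 p.1) := (continuous_fst.tendsto p).comp hp
  have hy : Tendsto (fun m => (ps m).2) l (𝓝 p.2) := (continuous_snd.tendsto p).comp hp
  have hN := tendsto_realization L hθ hx hA
  have hD : Tendsto (fun m => jacobian ℓ L (As m) (as m) (θs m) (ps m).1) l
      (𝓝 (jacobian ℓ L A a θ p.1)) :=
    tendsto_finsetSum _ fun i _ =>
      (((ContinuousLinearMap.smulRightL ℝ (Param ℓ L) (Layer ℓ L)).flip
        (EuclideanSpace.single i 1)).continuous.tendsto _).comp (tendsto_dRealization L hθ hA ha i)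
  have hF := ((hH.continuous_fderiv one_ne_zero).tendsto _).comp
    (hN.prodMk_nhds (hy.prodMk_nhds hθ))
  have hJ : Tendsto (fun m => (jacobian ℓ L (As m) (as m) (θs m) (ps m).1).prod
      ((0 : Param ℓ L →L[ℝ] Layer ℓ L).prod (.id ℝ _))) l
      (𝓝 ((jacobian ℓ L A a θ p.1).prod
        ((0 : Param ℓ L →L[ℝ] Layer ℓ L).prod (.id ℝ _)))) :=
    ((ContinuousLinearMap.prodₗᵢ ℝ (𝕜 := ℝ) (E := Param ℓ L) (F := Layer ℓ L)
      (G := Layer ℓ L × Param ℓ L)).continuous.tendsto _).comp (hD.prodMk_nhds tendsto_const_nhds)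
  exact ((ContinuousLinearMap.compL ℝ (Param ℓ L) (Layer ℓ L × Layer ℓ L × Param ℓ L)
    ℝ).continuous₂.tendsto _).comp (hF.prodMk_nhds hJ)

theorem continuous_dLoss (hH : ContDiff ℝ 1 H) {A a : ℝ → ℝ} (hA : Continuous A)
    (ha : Continuous a) :
    Continuous fun q : Param ℓ L × Layer ℓ 0 × Layer ℓ L => dLoss ℓ L H A a q.1 q.2 := by
  refine continuous_iff_continuousAt.2 fun q => ?_
  have hN : ∀ k j, Continuous fun q : Param ℓ L × Layer ℓ 0 × Layer ℓ L =>
      realization ℓ A q.1 q.2.1 k j := fun k j => by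
    have := (continuous_realization (ℓ := ℓ) (d := paramDim ℓ L) hA k).comp
      (continuous_fst.prodMk (continuous_fst.comp continuous_snd) :
        Continuous fun q : Param ℓ L × Layer ℓ 0 × Layer ℓ L => (q.1, q.2.1))
    exact (PiLp.continuous_apply 2 _ j).comp this
  exact tendsto_dLoss hH (As := fun _ => A) (as := fun _ => a) continuousAt_fst continuousAt_snd
    (fun k _ j => ((continuous_act hA k).comp (hN k j)).continuousAt)
    (fun k _ j => (ha.comp (hN k j)).continuousAt)

theorem continuous_lossAt (hH : Continuous H) {A : ℝ → ℝ} (hA : Continuous A) (θ : Param ℓ L) :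
    Continuous (lossAt ℓ L H A θ) :=
  hH.comp (((continuous_realization hA L).comp (continuous_const.prodMk continuous_fst)).prodMk
    (continuous_snd.prodMk continuous_const))

/-- The part of the integrand that dominates the derivatives of the loss. -/
def lossScale (H : Layer ℓ L × Layer ℓ L × Param ℓ L → ℝ) (p : Layer ℓ 0 × Layer ℓ L) : ℝ :=
  1 + |H (0, p.2, 0)|

theorem integrable_lossScale [IsFiniteMeasure μ] (hL : 0 < L)
    (hint : ∀ A : ℝ → ℝ, Continuous A → ∀ θ : Param ℓ L, Integrable (lossAt ℓ L H A θ) μ) :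
    Integrable (lossScale H) μ := by
  have h : ∀ p, lossAt ℓ L H id 0 p = H (0, p.2, 0) := fun p => by
    obtain ⟨k, rfl⟩ := Nat.exists_eq_succ_of_ne_zero hL.ne'
    have hent : ∀ n, entry (0 : Param ℓ (k + 1)) n = 0 := fun n => by simp [entry]
    have : realization ℓ id (0 : Param ℓ (k + 1)) p.1 (k + 1) = 0 := by
      ext i
      simp [realization_succ_apply, hent]
    rw [lossAt, this]
  have h' := hint id continuous_id 0
  simp only [funext h] at h'
  exact (integrable_const 1).add h'.abs

theorem norm_dLoss_le (hH : ContDiff ℝ 1 H) (A a : ℝ → ℝ) (θ : Param ℓ L)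
    (p : Layer ℓ 0 × Layer ℓ L) :
    ‖dLoss ℓ L H A a θ p‖ ≤
      ‖∇ (fun x' => H (x', p.2, θ)) (realization ℓ A θ p.1 L)‖ * ‖jacobian ℓ L A a θ p.1‖ +
        ‖∇ (fun θ' => H (realization ℓ A θ p.1 L, p.2, θ')) θ‖ := by
  set x := realization ℓ A θ p.1 L
  set F := fderiv ℝ H (x, p.2, θ)
  have hF : HasFDerivAt H F (x, p.2, θ) := (hH.differentiable one_ne_zero _).hasFDerivAt
  have h1 : ∀ v, F (v, 0, 0) = inner ℝ (∇ (fun x' => H (x', p.2, θ)) x) v := fun v => by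
    have : HasFDerivAt (fun x' => H (x', p.2, θ))
        (F.comp ((ContinuousLinearMap.id ℝ _).prod 0)) x :=
      hF.comp x ((hasFDerivAt_id x).prodMk (hasFDerivAt_const (p.2, θ) x))
    rw [inner_gradient_left, this.fderiv]
    rfl
  have h2 : ∀ v, F (0, 0, v) = inner ℝ (∇ (fun θ' => H (x, p.2, θ')) θ) v := fun v => by
    have : HasFDerivAt (fun θ' => H (x, p.2, θ'))
        (F.comp ((0 : Param ℓ L →L[ℝ] Layer ℓ L).prod
          ((0 : Param ℓ L →L[ℝ] Layer ℓ L).prod (.id ℝ _)))) θ :=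
      hF.comp θ ((hasFDerivAt_const x θ).prodMk ((hasFDerivAt_const p.2 θ).prodMk
        (hasFDerivAt_id θ)))
    rw [inner_gradient_left, this.fderiv]
    rfl
  refine ContinuousLinearMap.opNorm_le_bound _ (by positivity) fun v => ?_
  have hsplit : dLoss ℓ L H A a θ p v =
      F (jacobian ℓ L A a θ p.1 v, 0, 0) + F (0, 0, v) := by
    rw [← map_add]
    simp [dLoss, F, x]
  rw [hsplit, h1, h2, add_mul, mul_assoc]
  refine (norm_add_le _ _).trans (add_le_add ((norm_inner_le_norm _ _).trans ?_)
    (norm_inner_le_norm _ _))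
  exact mul_le_mul_of_nonneg_left (ContinuousLinearMap.le_opNorm _ _) (norm_nonneg _)

theorem exists_bound_dLoss (hμ : Bornology.IsBounded {x | ∃ y, (x, y) ∈ μ.support})
    (hH : ContDiff ℝ 1 H) (hgrowth : GradGrowth ℓ L H μ) {ι : Type*} {As as : ι → ℝ → ℝ}
    (hb : ∀ r : ℝ, ∃ C : ℝ, ∀ i y, |y| ≤ r → |As i y| ≤ C ∧ |as i y| ≤ C) (r : ℝ) :
    ∃ C : ℝ, 0 ≤ C ∧ ∀ i (θ : Param ℓ L), ‖θ‖ ≤ r → ∀ p ∈ μ.support,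
      ‖dLoss ℓ L H (As i) (as i) θ p‖ ≤ C * lossScale H p := by
  obtain ⟨r', hr'⟩ := hμ.exists_norm_le
  obtain ⟨B, hB⟩ := exists_bound_realization (ℓ := ℓ) (d := paramDim ℓ L) hb (max r r') L
  set R := max (max r B) 1
  obtain ⟨C, hC⟩ := hgrowth R (by positivity) 0 0 (fun i => by simp [R]) (fun i => by simp [R])
  refine ⟨max C 0 * (ℓ L * |B| + 1), by positivity, fun i θ hθ p hp => ?_⟩
  have hbd := hB i θ p.1 (hθ.trans (le_max_left _ _))
    ((hr' _ ⟨p.2, hp⟩).trans (le_max_right _ _))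
  have hgr := hC (realization ℓ (As i) θ p.1 L) p.1 p.2 θ
    (fun j => (hbd j).1.trans ((le_max_right _ _).trans (le_max_left _ _)))
    (fun j => (PiLp.norm_apply_le θ j).trans
      (hθ.trans ((le_max_left _ _).trans (le_max_left _ _)))) hp
  have hpos : 0 < lossScale H p := by
    unfold lossScale
    positivity
  have hgr' : _ ≤ C * lossScale H p := (div_le_iff₀ hpos).1 hgr
  have hjac : ‖jacobian ℓ L (As i) (as i) θ p.1‖ ≤ ℓ L * |B| := by
    refine (norm_sum_le _ _).trans ?_
    refine (Finset.sum_le_card_nsmul _ _ |B| fun j _ => ?_).trans (by simp)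
    simpa [ContinuousLinearMap.norm_smulRight_apply] using (hbd j).2.trans (le_abs_self B)
  refine (norm_dLoss_le hH _ _ θ p).trans ?_
  set u := ‖∇ (fun x' => H (x', p.2, θ)) (realization ℓ (As i) θ p.1 L)‖
  set v := ‖∇ (fun θ' => H (realization ℓ (As i) θ p.1 L, p.2, θ')) θ‖
  have hu : 0 ≤ u := norm_nonneg _
  have hv : 0 ≤ v := norm_nonneg _
  have hBn : (0 : ℝ) ≤ ℓ L * |B| := by positivity
  calc u * ‖jacobian ℓ L (As i) (as i) θ p.1‖ + v ≤ u * (ℓ L * |B|) + v := by gcongr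
    _ ≤ (u + v) * (ℓ L * |B| + 1) := by nlinarith
    _ ≤ (C * lossScale H p) * (ℓ L * |B| + 1) := by gcongr
    _ ≤ (max C 0 * lossScale H p) * (ℓ L * |B| + 1) := by gcongr; exact le_max_left _ _
    _ = _ := by ring

theorem ae_mem_support : ∀ᵐ p ∂μ, p ∈ μ.support := Measure.support_mem_ae

section Smooth

variable [IsFiniteMeasure μ]

theorem exists_bound_of_continuous {A a : ℝ → ℝ} (hA : Continuous A) (ha : Continuous a) (r : ℝ) :
    ∃ C : ℝ, ∀ (_ : Unit) (y : ℝ), |y| ≤ r → |A y| ≤ C ∧ |a y| ≤ C := by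
  obtain ⟨C, hC⟩ := (isCompact_Icc (a := -r) (b := r)).exists_bound_of_continuousOn hA.continuousOn
  obtain ⟨B, hB⟩ := (isCompact_Icc (a := -r) (b := r)).exists_bound_of_continuousOn ha.continuousOn
  exact ⟨max C B, fun _ y hy => ⟨(hC y (abs_le.1 hy)).trans (le_max_left _ _),
    (hB y (abs_le.1 hy)).trans (le_max_right _ _)⟩⟩

theorem hasFDerivAt_risk_of_contDiff (hL : 0 < L)
    (hμ : Bornology.IsBounded {x | ∃ y, (x, y) ∈ μ.support}) (hH : ContDiff ℝ 1 H)
    (hint : ∀ A : ℝ → ℝ, Continuous A → ∀ θ : Param ℓ L, Integrable (lossAt ℓ L H A θ) μ)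
    (hgrowth : GradGrowth ℓ L H μ) {A : ℝ → ℝ} (hA : ContDiff ℝ 1 A) (θ : Param ℓ L) :
    HasFDerivAt (risk ℓ L H μ A) (∫ p, dLoss ℓ L H A (deriv A) θ p ∂μ) θ := by
  have hA' := hA.continuous_deriv le_rfl
  obtain ⟨C, -, hC⟩ := exists_bound_dLoss hμ hH hgrowth
    (exists_bound_of_continuous hA.continuous hA') (‖θ‖ + 1)
  refine hasFDerivAt_integral_of_dominated_of_fderiv_le (Metric.ball_mem_nhds θ one_pos)
    (F := lossAt ℓ L H A) (F' := dLoss ℓ L H A (deriv A)) (bound := fun p => C * lossScale H p)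
    (Eventually.of_forall fun θ' =>
      (continuous_lossAt hH.continuous hA.continuous θ').aestronglyMeasurable)
    (hint A hA.continuous θ)
    ((continuous_dLoss hH hA.continuous hA').comp
      (continuous_const.prodMk continuous_id)).aestronglyMeasurable
    ?_ ((integrable_lossScale hL hint).const_mul C) ?_
  · filter_upwards [ae_mem_support] with p hp θ' hθ'
    refine hC () θ' ?_ p hp
    have := norm_sub_norm_le θ' θ
    have := mem_ball_iff_norm.1 hθ'
    linarith
  · exact Eventually.of_forall fun p θ' _ => hasFDerivAt_lossAt hH fun k _ _ j =>
      (hA.differentiable one_ne_zero _).hasDerivAt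

theorem contDiff_risk (hL : 0 < L)
    (hμ : Bornology.IsBounded {x | ∃ y, (x, y) ∈ μ.support}) (hH : ContDiff ℝ 1 H)
    (hint : ∀ A : ℝ → ℝ, Continuous A → ∀ θ : Param ℓ L, Integrable (lossAt ℓ L H A θ) μ)
    (hgrowth : GradGrowth ℓ L H μ) {A : ℝ → ℝ} (hA : ContDiff ℝ 1 A) :
    ContDiff ℝ 1 (risk ℓ L H μ A) := by
  have hd := hasFDerivAt_risk_of_contDiff hL hμ hH hint hgrowth hA
  have hA' := hA.continuous_deriv le_rfl
  have hc := continuous_dLoss hH hA.continuous hA'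
  refine contDiff_one_iff_fderiv.2 ⟨fun θ => (hd θ).differentiableAt, ?_⟩
  rw [show fderiv ℝ (risk ℓ L H μ A) = _ from funext fun θ => (hd θ).fderiv]
  refine continuous_iff_continuousAt.2 fun θ => ?_
  obtain ⟨C, -, hC⟩ := exists_bound_dLoss hμ hH hgrowth
    (exists_bound_of_continuous hA.continuous hA') (‖θ‖ + 1)
  refine continuousAt_of_dominated (bound := fun p => C * lossScale H p)
    (Eventually.of_forall fun θ' =>
      (hc.comp (continuous_const.prodMk continuous_id)).aestronglyMeasurable) ?_
    ((integrable_lossScale hL hint).const_mul C)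
    (Eventually.of_forall fun p => (hc.comp (continuous_id.prodMk continuous_const)).continuousAt)
  filter_upwards [Metric.ball_mem_nhds θ one_pos] with θ' hθ'
  filter_upwards [ae_mem_support] with p hp
  refine hC () θ' ?_ p hp
  have := norm_sub_norm_le θ' θ
  have := mem_ball_iff_norm.1 hθ'
  linarith

end Smooth

end DeepANN

namespace DeepANN

variable {ℓ : ℕ → ℕ} {L : ℕ} {μ : Measure (Layer ℓ 0 × Layer ℓ L)}

theorem continuous_realization_apply {X : Type*} [TopologicalSpace X] {A : ℝ → ℝ}
    (hA : Continuous A) {θ : X → Param ℓ L} {x : X → Layer ℓ 0} (hθ : Continuous θ)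
    (hx : Continuous x) (k : ℕ) (i : Fin (ℓ k)) :
    Continuous fun q => realization ℓ A (θ q) (x q) k i :=
  (PiLp.continuous_apply 2 _ i).comp ((continuous_realization hA k).comp (hθ.prodMk hx))

/-- For almost all parameters, almost no data point makes a neuron take a value in `S`. -/
theorem ae_realization_notMem [SFinite μ] {g : ℝ → ℝ} (hg : Continuous g) (S : Finset ℝ) :
    ∀ᵐ θ : Param ℓ L, ∀ᵐ p ∂μ, ∀ k < L, ∀ i : Fin (ℓ (k + 1)),
      realization ℓ g θ p.1 (k + 1) i ∉ S := by
  have hmeas : MeasurableSet {q : Param ℓ L × Layer ℓ 0 × Layer ℓ L |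
      ∀ k < L, ∀ i : Fin (ℓ (k + 1)), realization ℓ g q.1 q.2.1 (k + 1) i ∉ S} := by
    have : {q : Param ℓ L × Layer ℓ 0 × Layer ℓ L |
        ∀ k < L, ∀ i : Fin (ℓ (k + 1)), realization ℓ g q.1 q.2.1 (k + 1) i ∉ S} =
        ⋂ k, ⋂ (_ : k < L), ⋂ i : Fin (ℓ (k + 1)),
          (fun q : Param ℓ L × Layer ℓ 0 × Layer ℓ L =>
            realization ℓ g q.1 q.2.1 (k + 1) i) ⁻¹' (S : Set ℝ)ᶜ := by
      ext q
      simp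
    rw [this]
    refine MeasurableSet.iInter fun k => MeasurableSet.iInter fun _ => MeasurableSet.iInter
      fun i => ?_
    exact (continuous_realization_apply hg continuous_fst
      (continuous_fst.comp continuous_snd) _ i).measurable S.measurableSet.compl
  rw [Measure.ae_ae_comm hmeas]
  refine Eventually.of_forall fun p => ?_
  rw [ae_all_iff]
  intro k
  by_cases hk : k < L
  swap
  · exact Eventually.of_forall fun θ h => absurd h hk
  simp only [hk, true_imp_iff]
  rw [ae_all_iff]
  intro i
  have hset : MeasurableSet {θ : Param ℓ L | realization ℓ g θ p.1 (k + 1) i ∉ S} :=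
    (continuous_realization_apply hg continuous_id continuous_const _ i).measurable
      S.measurableSet.compl
  refine ae_mem_of_ae_add_linearMap_mem
    (LinearMap.toSpanSingleton ℝ (Param ℓ L) (biasShift ℓ _ k)) volume volume hset fun θ => ?_
  have hfin : {t : ℝ | realization ℓ g θ p.1 (k + 1) i + t ∈ S}.Finite :=
    S.finite_toSet.preimage (add_right_injective _).injOn
  have hae : ∀ᵐ t : ℝ, t ∉ {t : ℝ | realization ℓ g θ p.1 (k + 1) i + t ∈ S} :=
    compl_mem_ae_iff.2 (hfin.measure_zero _)
  filter_upwards [hae] with t ht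
  change realization ℓ g (θ + t • biasShift ℓ _ k) p.1 (k + 1) i ∉ S
  rwa [realization_add_smul_biasShift_succ g θ p.1 t hk i]

/-- All neurons of the first `k` layers can be moved strictly in the direction `σ`, uniformly on a
compact set of inputs, by an arbitrarily small change of the parameters. -/
theorem exists_near_realization_lt {g : ℝ → ℝ} (hg : Continuous g) {σ : ℝ} (hσ : |σ| = 1)
    {K : Set (Layer ℓ 0)} (hK : IsCompact K) (θ : Param ℓ L) (k : ℕ) (hk : k ≤ L) {ε : ℝ}
    (hε : 0 < ε) :
    ∃ θ' : Param ℓ L, dist θ' θ < ε ∧ ∀ x ∈ K, ∀ j < k, ∀ i : Fin (ℓ (j + 1)),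
      0 < σ * (realization ℓ g θ' x (j + 1) i - realization ℓ g θ x (j + 1) i) := by
  induction k generalizing ε with
  | zero => exact ⟨θ, by simpa using hε, by simp⟩
  | succ k ih =>
    obtain ⟨t, ht, htε⟩ : ∃ t : ℝ, 0 < t ∧ t * ‖biasShift ℓ (paramDim ℓ L) k‖ < ε / 2 := by
      refine ⟨ε / 2 / (‖biasShift ℓ (paramDim ℓ L) k‖ + 1), by positivity, ?_⟩
      rw [div_mul_eq_mul_div, div_lt_iff₀ (by positivity)]
      nlinarith [norm_nonneg (biasShift ℓ (paramDim ℓ L) k)]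
    have hev : ∀ᶠ θ' in 𝓝 θ, ∀ x ∈ K, ∀ i,
        |realization ℓ g θ' x (k + 1) i - realization ℓ g θ x (k + 1) i| < t := by
      refine hK.eventually_forall_of_forall_eventually
        (P := fun (θ' : Param ℓ L) x => ∀ i,
          |realization ℓ g θ' x (k + 1) i - realization ℓ g θ x (k + 1) i| < t) fun x _ => ?_
      refine eventually_all.2 fun i => ?_
      have hc : Continuous fun q : Param ℓ L × Layer ℓ 0 =>
          |realization ℓ g q.1 q.2 (k + 1) i - realization ℓ g θ q.2 (k + 1) i| :=
        ((continuous_realization_apply hg continuous_fst continuous_snd _ i).sub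
          (continuous_realization_apply hg continuous_const continuous_snd _ i)).abs
      exact hc.continuousAt.eventually (gt_mem_nhds (by simpa using ht))
    obtain ⟨η, hη, hball⟩ := Metric.eventually_nhds_iff.1 hev
    obtain ⟨θ₁, hθ₁, hlt⟩ := ih (Nat.le_of_succ_le hk) (lt_min hη (half_pos hε))
    refine ⟨θ₁ + (σ * t) • biasShift ℓ _ k, ?_, fun x hx j hj i => ?_⟩
    · have h1 : dist (θ₁ + (σ * t) • biasShift ℓ _ k) θ₁ < ε / 2 := by
        rw [dist_eq_norm, add_sub_cancel_left, norm_smul, Real.norm_eq_abs, abs_mul, hσ, one_mul,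
          abs_of_pos ht]
        exact htε
      have h2 := hθ₁.trans_le (min_le_right _ _)
      linarith [dist_triangle (θ₁ + (σ * t) • biasShift ℓ _ k) θ₁ θ]
    · rcases Nat.lt_succ_iff_lt_or_eq.1 hj with hj | rfl
      · rw [realization_add_smul_biasShift_of_le g θ₁ x _ hj]
        exact hlt x hx j hj i
      · rw [realization_add_smul_biasShift_succ g θ₁ x _ hk i]
        have h := hball (hθ₁.trans_le (min_le_left _ _)) x hx i
        set u := realization ℓ g θ₁ x (j + 1) i - realization ℓ g θ x (j + 1) i
        have hσ2 : σ * σ = 1 := by rw [← abs_mul_abs_self, hσ, one_mul]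
        have hu : -|σ * u| ≤ σ * u := neg_abs_le _
        rw [abs_mul, hσ, one_mul] at hu
        have : σ * (realization ℓ g θ₁ x (j + 1) i + σ * t - realization ℓ g θ x (j + 1) i) =
            σ * u + (σ * σ) * t := by ring
        rw [this, hσ2]
        linarith

/-- Every parameter is the limit of parameters for which almost no data point makes a neuron take a
value in `S`, and for which all neurons have moved strictly in the direction `σ`. -/
theorem exists_seq_generic [SFinite μ] (hμ : Bornology.IsBounded {x | ∃ y, (x, y) ∈ μ.support})
    {g : ℝ → ℝ} (hg : Continuous g) (S : Finset ℝ) {σ : ℝ} (hσ : |σ| = 1) (θ : Param ℓ L) :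
    ∃ θs : ℕ → Param ℓ L, Tendsto θs atTop (𝓝 θ) ∧
      (∀ n, ∀ᵐ p ∂μ, ∀ k < L, ∀ i : Fin (ℓ (k + 1)),
        realization ℓ g (θs n) p.1 (k + 1) i ∉ S) ∧
      ∀ n, ∀ p ∈ μ.support, ∀ k < L, ∀ i : Fin (ℓ (k + 1)),
        0 < σ * (realization ℓ g (θs n) p.1 (k + 1) i - realization ℓ g θ p.1 (k + 1) i) := by
  obtain ⟨r, hr⟩ := hμ.exists_norm_le
  have hK : IsCompact (Metric.closedBall (0 : Layer ℓ 0) r) := isCompact_closedBall 0 r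
  have hdense : Dense {θ : Param ℓ L | ∀ᵐ p ∂μ, ∀ k < L, ∀ i : Fin (ℓ (k + 1)),
      realization ℓ g θ p.1 (k + 1) i ∉ S} :=
    Measure.dense_of_ae (ae_realization_notMem hg S)
  have hex : ∀ ε : ℝ, 0 < ε → ∃ θ' : Param ℓ L, dist θ' θ < ε ∧
      (∀ᵐ p ∂μ, ∀ k < L, ∀ i : Fin (ℓ (k + 1)), realization ℓ g θ' p.1 (k + 1) i ∉ S) ∧
      ∀ p ∈ μ.support, ∀ k < L, ∀ i : Fin (ℓ (k + 1)),
        0 < σ * (realization ℓ g θ' p.1 (k + 1) i - realization ℓ g θ p.1 (k + 1) i) := by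
    intro ε hε
    obtain ⟨θ₁, hθ₁, hlt⟩ := exists_near_realization_lt hg hσ hK θ L le_rfl hε
    have hev : ∀ᶠ θ' in 𝓝 θ₁, ∀ x ∈ Metric.closedBall (0 : Layer ℓ 0) r, ∀ k ∈ Finset.range L,
        ∀ i : Fin (ℓ (k + 1)),
        0 < σ * (realization ℓ g θ' x (k + 1) i - realization ℓ g θ x (k + 1) i) := by
      refine hK.eventually_forall_of_forall_eventually
        (P := fun (θ' : Param ℓ L) x => ∀ k ∈ Finset.range L, ∀ i : Fin (ℓ (k + 1)),
        0 < σ * (realization ℓ g θ' x (k + 1) i - realization ℓ g θ x (k + 1) i)) fun x hx => ?_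
      refine (Filter.eventually_all_finset _).2 fun k hk => eventually_all.2 fun i => ?_
      have hc : Continuous fun q : Param ℓ L × Layer ℓ 0 =>
          σ * (realization ℓ g q.1 q.2 (k + 1) i - realization ℓ g θ q.2 (k + 1) i) :=
        continuous_const.mul
          ((continuous_realization_apply hg continuous_fst continuous_snd _ i).sub
            (continuous_realization_apply hg continuous_const continuous_snd _ i))
      exact hc.continuousAt.eventually (lt_mem_nhds (hlt x hx k (Finset.mem_range.1 hk) i))
    obtain ⟨θ', hgen, hlt', hd⟩ := (mem_closure_iff_frequently.1 (hdense θ₁)).and_eventually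
      (hev.and (continuous_id.dist continuous_const |>.continuousAt.eventually
        (gt_mem_nhds hθ₁))) |>.exists
    exact ⟨θ', hd, hgen, fun p hp k hk i => hlt' p.1
      (mem_closedBall_zero_iff.2 (hr _ ⟨p.2, hp⟩)) k (Finset.mem_range.2 hk) i⟩
  choose! f hf using hex
  have hpos : ∀ n : ℕ, (0 : ℝ) < 1 / (n + 1) := fun n => by positivity
  refine ⟨fun n => f (1 / (n + 1)), ?_, fun n => (hf _ (hpos n)).2.1, fun n => (hf _ (hpos n)).2.2⟩
  exact tendsto_iff_dist_tendsto_zero.2 (squeeze_zero (fun _ => dist_nonneg)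
    (fun n => (hf _ (hpos n)).1.le) tendsto_one_div_add_atTop_nhds_zero_nat)

end DeepANN

namespace DeepANN

variable {ℓ : ℕ → ℕ} {L : ℕ} {H : Layer ℓ L × Layer ℓ L × Param ℓ L → ℝ}
  {μ : Measure (Layer ℓ 0 × Layer ℓ L)}

theorem boundWeight_nonneg {E : Type*} [TopologicalSpace E] [MeasurableSpace E] (z : ℕ)
    (ν : Measure E) : 0 ≤ boundWeight z ν :=
  add_nonneg (Nat.cast_nonneg z) (Set.indicator_nonneg (fun _ _ => zero_le_one) _)

theorem finite_support_of_boundWeight_eq_zero {E : Type*} [TopologicalSpace E]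
    [MeasurableSpace E] {z : ℕ} {ν : Measure E} (h : boundWeight z ν = 0) : ν.support.Finite := by
  by_contra hinf
  have htop : ν.support.encard = ⊤ := Set.encard_eq_top hinf
  have : (0 : ℝ) ≤ z := Nat.cast_nonneg z
  simp only [boundWeight, htop, Set.mem_singleton_iff, Set.indicator_of_mem] at h
  linarith

theorem continuousWithinAt_of_oneSidedOsc_eq_zero {a : ℝ → ℝ} {S : Finset ℝ} {σ : ℝ}
    (hσ : |σ| = 1) (h : oneSidedOsc a S σ = 0) {s : ℝ} (hs : s ∈ S) :
    ContinuousWithinAt a {y | 0 < σ * (y - s)} s := by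
  have hσ2 : σ * σ = 1 := by rw [← abs_mul_abs_self, hσ, one_mul]
  have hlim : limsup (fun h : ℝ => ‖a (s + σ * h) - a s‖ₑ) (𝓝[>] 0) = 0 :=
    Finset.sum_eq_zero_iff.1 h s hs
  have ht : Tendsto (fun h : ℝ => ‖a (s + σ * h) - a s‖ₑ) (𝓝[>] 0) (𝓝 0) :=
    tendsto_of_le_liminf_of_limsup_le zero_le hlim.le
  have hmap : Tendsto (fun y => σ * (y - s)) (𝓝[{y | 0 < σ * (y - s)}] s) (𝓝[>] 0) := by
    refine tendsto_nhdsWithin_iff.2 ⟨?_, eventually_mem_nhdsWithin⟩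
    have hc : Continuous fun y => σ * (y - s) := by fun_prop
    simpa using (hc.tendsto s).mono_left nhdsWithin_le_nhds
  refine tendsto_iff_edist_tendsto_0.2 ((ht.comp hmap).congr fun y => ?_)
  rw [edist_eq_enorm_sub, Function.comp_apply, ← mul_assoc, hσ2]
  congr 3
  ring

namespace IsApprox

variable {g a : ℝ → ℝ} {w : ℝ} {A : ℕ → ℝ → ℝ}

theorem eventually (h : IsApprox g a w A) (x : ℝ) :
    ∀ᶠ n in atTop, A n x = g x ∧ deriv (A n) x = a x := by
  obtain ⟨m, hm⟩ := h.eventually_eq x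
  filter_upwards [eventually_ge_atTop m] with n hn
  have h0 := ENNReal.tsum_eq_zero.1 hm (n - m)
  rw [Nat.add_sub_cancel' hn, add_eq_zero, enorm_eq_zero, enorm_eq_zero, sub_eq_zero,
    sub_eq_zero] at h0
  exact ⟨h0.1.symm, h0.2.symm⟩

theorem eventually_realization (h : IsApprox g a w A) (θ : Param ℓ L) (x : Layer ℓ 0) (k : ℕ) :
    ∀ᶠ n in atTop, realization ℓ (A n) θ x k = realization ℓ g θ x k := by
  have hev : ∀ᶠ n in atTop, ∀ m ∈ Finset.range k, ∀ j,
      A n (realization ℓ g θ x m j) = g (realization ℓ g θ x m j) :=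
    (Filter.eventually_all_finset _).2 fun m _ => eventually_all.2 fun j =>
      (h.eventually _).mono fun n hn => hn.1
  exact hev.mono fun n hn => (realization_congr_act k fun m hm j =>
    (hn m (Finset.mem_range.2 hm) j).symm).symm

theorem eventually_lossAt (h : IsApprox g a w A) (θ : Param ℓ L) (p : Layer ℓ 0 × Layer ℓ L) :
    ∀ᶠ n in atTop, lossAt ℓ L H (A n) θ p = lossAt ℓ L H g θ p :=
  (h.eventually_realization θ p.1 L).mono fun n hn => by rw [lossAt, lossAt, hn]

theorem tendsto_dLoss (h : IsApprox g a w A) (hH : ContDiff ℝ 1 H) (θ : Param ℓ L)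
    (p : Layer ℓ 0 × Layer ℓ L) :
    Tendsto (fun n => dLoss ℓ L H (A n) (deriv (A n)) θ p) atTop (𝓝 (dLoss ℓ L H g a θ p)) := by
  refine DeepANN.tendsto_dLoss hH tendsto_const_nhds tendsto_const_nhds (fun k _ j => ?_)
    fun k _ j => ?_
  · refine tendsto_const_nhds.congr' ?_
    filter_upwards [h.eventually_realization θ p.1 k,
      h.eventually (realization ℓ g θ p.1 k j)] with n h1 h2
    simp only [act, h1, h2.1]
  · refine tendsto_const_nhds.congr' ?_
    filter_upwards [h.eventually_realization θ p.1 k,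
      h.eventually (realization ℓ g θ p.1 k j)] with n h1 h2
    rw [h1, h2.2]

theorem exists_bound (h : IsApprox g a w A) (hw : 0 < w) (r : ℝ) :
    ∃ C : ℝ, ∀ n y, |y| ≤ r → |A n y| ≤ C ∧ |deriv (A n) y| ≤ C := by
  obtain ⟨C, hC⟩ := h.bounded ⌈r⌉₊
  refine ⟨C / w, fun n y hy => ?_⟩
  have := (le_div_iff₀ hw).2 (hC n y (abs_le.1 (hy.trans (Nat.le_ceil r))))
  exact ⟨(le_add_of_nonneg_right (abs_nonneg _)).trans this,
    (le_add_of_nonneg_left (abs_nonneg _)).trans this⟩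

theorem aestronglyMeasurable_dLoss (h : IsApprox g a w A) (hH : ContDiff ℝ 1 H) (θ : Param ℓ L) :
    AEStronglyMeasurable (dLoss ℓ L H g a θ) μ :=
  aestronglyMeasurable_of_tendsto_ae atTop (fun n =>
    ((continuous_dLoss hH (h.contDiff n).continuous ((h.contDiff n).continuous_deriv le_rfl)).comp
      (continuous_const.prodMk continuous_id)).aestronglyMeasurable)
    (Eventually.of_forall fun p => h.tendsto_dLoss hH θ p)

end IsApprox

section Support

variable {E V : Type*} [TopologicalSpace E] [MeasurableSpace E] [BorelSpace E] [T1Space E]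
  [SecondCountableTopology E] {ν : Measure E} [IsFiniteMeasure ν] [NormedAddCommGroup V]
  [NormedSpace ℝ V] [CompleteSpace V]

theorem integral_eq_sum_of_finite_support (h : ν.support.Finite) (f : E → V) :
    ∫ p, f p ∂ν = ∑ p ∈ h.toFinset, ν.real {p} • f p := by
  have hae : ∀ᵐ p ∂ν, p ∈ (h.toFinset : Set E) := by
    simpa using (Measure.support_mem_ae : ν.support ∈ ae ν)
  rw [← setIntegral_finset _ IntegrableOn.finset, Measure.restrict_eq_self_of_ae_mem hae]

/-- Convergence of integrals, either by domination or because the measure has finite support. -/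
theorem tendsto_integral_of_support {F : ℕ → E → V} {f : E → V} {b : E → ℝ}
    (hmeas : ∀ n, AEStronglyMeasurable (F n) ν) (hb : Integrable b ν)
    (hlim : ∀ p ∈ ν.support, Tendsto (fun n => F n p) atTop (𝓝 (f p)))
    (h : ν.support.Finite ∨ ∃ C : ℝ, ∀ n, ∀ p ∈ ν.support, ‖F n p‖ ≤ C * b p) :
    Tendsto (fun n => ∫ p, F n p ∂ν) atTop (𝓝 (∫ p, f p ∂ν)) := by
  have hae : ∀ᵐ p ∂ν, p ∈ ν.support := Measure.support_mem_ae
  rcases h with h | ⟨C, hC⟩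
  · simp only [integral_eq_sum_of_finite_support h]
    exact tendsto_finsetSum _ fun p hp => (hlim p (h.mem_toFinset.1 hp)).const_smul _
  · exact tendsto_integral_of_dominated_convergence (fun p => C * b p) hmeas (hb.const_mul C)
      (fun n => hae.mono fun p hp => hC n p hp) (hae.mono hlim)

end Support

section Limits

variable [IsFiniteMeasure μ] {g a : ℝ → ℝ} {w : ℝ}

theorem IsApprox.tendsto_integral_dLoss {A : ℕ → ℝ → ℝ} (h : IsApprox g a w A) (hL : 0 < L)
    (hμ : Bornology.IsBounded {x | ∃ y, (x, y) ∈ μ.support}) (hH : ContDiff ℝ 1 H)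
    (hint : ∀ A : ℝ → ℝ, Continuous A → ∀ θ : Param ℓ L, Integrable (lossAt ℓ L H A θ) μ)
    (hgrowth : GradGrowth ℓ L H μ) (hw : μ.support.Finite ∨ 0 < w) (θ : Param ℓ L) :
    Tendsto (fun n => ∫ p, dLoss ℓ L H (A n) (deriv (A n)) θ p ∂μ) atTop
      (𝓝 (∫ p, dLoss ℓ L H g a θ p ∂μ)) := by
  refine tendsto_integral_of_support (fun n => ?_) (integrable_lossScale hL hint)
    (fun p _ => h.tendsto_dLoss hH θ p) (hw.imp_right fun hw => ?_)
  · exact ((continuous_dLoss hH (h.contDiff n).continuous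
      ((h.contDiff n).continuous_deriv le_rfl)).comp
      (continuous_const.prodMk continuous_id)).aestronglyMeasurable
  · obtain ⟨C, -, hC⟩ := exists_bound_dLoss hμ hH hgrowth (h.exists_bound hw) ‖θ‖
    exact ⟨C, fun n p hp => hC n θ le_rfl p hp⟩

/-- The risk of a piecewise smooth activation is differentiable at all parameters for which almost
no data point makes a neuron take an exceptional value. -/
theorem hasFDerivAt_risk_of_generic {A : ℕ → ℝ → ℝ} (h : IsApprox g a w A) (hL : 0 < L)
    (hμ : Bornology.IsBounded {x | ∃ y, (x, y) ∈ μ.support}) (hH : ContDiff ℝ 1 H)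
    (hint : ∀ A : ℝ → ℝ, Continuous A → ∀ θ : Param ℓ L, Integrable (lossAt ℓ L H A θ) μ)
    (hgrowth : GradGrowth ℓ L H μ) (hw : μ.support.Finite ∨ 0 < w) (hg : Continuous g)
    {S : Finset ℝ} (hd : ∀ x ∉ S, HasDerivAt g (a x) x) {θ : Param ℓ L}
    (hθ : ∀ᵐ p ∂μ, ∀ k < L, ∀ i : Fin (ℓ (k + 1)), realization ℓ g θ p.1 (k + 1) i ∉ S) :
    HasFDerivAt (risk ℓ L H μ g) (∫ p, dLoss ℓ L H g a θ p ∂μ) θ := by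
  have hdiff : ∀ᵐ p ∂μ, HasFDerivAt (fun θ' => lossAt ℓ L H g θ' p) (dLoss ℓ L H g a θ p) θ := by
    filter_upwards [hθ] with p hp
    refine hasFDerivAt_lossAt hH fun k hk hk0 j => ?_
    obtain ⟨m, rfl⟩ := Nat.exists_eq_succ_of_ne_zero hk0
    exact hd _ (hp m (Nat.lt_of_succ_lt hk) j)
  rcases hw with hfin | hw
  · have hrisk : risk ℓ L H μ g =
        fun θ => ∑ p ∈ hfin.toFinset, μ.real {p} • lossAt ℓ L H g θ p :=
      funext fun θ => integral_eq_sum_of_finite_support hfin _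
    rw [hrisk, integral_eq_sum_of_finite_support hfin]
    refine HasFDerivAt.fun_sum fun p _ => ?_
    by_cases hp : μ {p} = 0
    · simpa [Measure.real, hp] using hasFDerivAt_const (0 : ℝ) θ
    · obtain ⟨q, hq, hqd⟩ := ((frequently_ae_mem_iff.2 hp).and_eventually hdiff).exists
      obtain rfl := Set.mem_singleton_iff.1 hq
      exact hqd.fun_const_smul (μ.real {q})
  · obtain ⟨C, hC0, hC⟩ := exists_bound_dLoss hμ hH hgrowth (h.exists_bound hw) (‖θ‖ + 1)
    refine (hasFDerivAt_integral_of_dominated_loc_of_lip (F := lossAt ℓ L H g)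
      (Metric.ball_mem_nhds θ one_pos) (bound := fun p => C * lossScale H p)
      (Eventually.of_forall fun θ' => (continuous_lossAt hH.continuous hg θ').aestronglyMeasurable)
      (hint g hg θ) (h.aestronglyMeasurable_dLoss hH θ) ?_
      ((integrable_lossScale hL hint).const_mul C) hdiff).2
    filter_upwards [ae_mem_support] with p hp
    refine LipschitzOnWith.of_dist_le_mul fun θ₁ h₁ θ₂ h₂ => ?_
    obtain ⟨n, hn₁, hn₂⟩ := ((h.eventually_lossAt (H := H) θ₁ p).and
      (h.eventually_lossAt (H := H) θ₂ p)).exists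
    rw [← hn₁, ← hn₂, dist_eq_norm, dist_eq_norm, Real.coe_nnabs]
    refine ((convex_ball θ 1).norm_image_sub_le_of_norm_hasFDerivWithin_le
      (f := fun θ' => lossAt ℓ L H (A n) θ' p)
      (f' := fun θ' => dLoss ℓ L H (A n) (deriv (A n)) θ' p)
      (fun θ' _ => (hasFDerivAt_lossAt hH fun k _ _ j =>
        ((h.contDiff n).differentiable one_ne_zero _).hasDerivAt).hasFDerivWithinAt)
      (fun θ' hθ' => hC n θ' ?_ p hp) h₂ h₁).trans
      (mul_le_mul_of_nonneg_right (le_abs_self _) (norm_nonneg _))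
    have := norm_sub_norm_le θ' θ
    have := mem_ball_iff_norm.1 hθ'
    linarith

/-- The formal derivative of the risk converges along sequences of parameters for which all neurons
move strictly to the side on which `a` is continuous. -/
theorem tendsto_integral_dLoss_of_lt {A : ℕ → ℝ → ℝ} (h : IsApprox g a w A) (hL : 0 < L)
    (hμ : Bornology.IsBounded {x | ∃ y, (x, y) ∈ μ.support}) (hH : ContDiff ℝ 1 H)
    (hint : ∀ A : ℝ → ℝ, Continuous A → ∀ θ : Param ℓ L, Integrable (lossAt ℓ L H A θ) μ)
    (hgrowth : GradGrowth ℓ L H μ) (hg : Continuous g)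
    (ha : μ.support.Finite ∨ ∀ r : ℝ, ∃ C : ℝ, ∀ x, |x| ≤ r → |a x| ≤ C) {σ : ℝ}
    (hs : ∀ x, ContinuousWithinAt a {y | 0 < σ * (y - x)} x) {θs : ℕ → Param ℓ L} {θ : Param ℓ L}
    (hθ : Tendsto θs atTop (𝓝 θ))
    (hlt : ∀ n, ∀ p ∈ μ.support, ∀ k < L, ∀ i : Fin (ℓ (k + 1)),
      0 < σ * (realization ℓ g (θs n) p.1 (k + 1) i - realization ℓ g θ p.1 (k + 1) i)) :
    Tendsto (fun n => ∫ p, dLoss ℓ L H g a (θs n) p ∂μ) atTop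
      (𝓝 (∫ p, dLoss ℓ L H g a θ p ∂μ)) := by
  refine tendsto_integral_of_support (fun n => h.aestronglyMeasurable_dLoss hH _)
    (integrable_lossScale hL hint) (fun p hp => ?_) (ha.imp_right fun ha => ?_)
  · have hN : ∀ k j, Tendsto (fun n => realization ℓ g (θs n) p.1 k j) atTop
        (𝓝 (realization ℓ g θ p.1 k j)) := fun k j =>
      ((continuous_realization_apply hg continuous_id continuous_const k j).tendsto θ).comp hθ
    refine tendsto_dLoss hH (As := fun _ => g) (as := fun _ => a) hθ tendsto_const_nhds
      (fun k _ j => ((continuous_act hg k).tendsto _).comp (hN k j)) fun k hk j => ?_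
    rcases k with _ | k
    · exact tendsto_const_nhds
    · exact (hs _).tendsto.comp (tendsto_nhdsWithin_iff.2 ⟨hN (k + 1) j,
        Eventually.of_forall fun n => hlt n p hp k (Nat.lt_of_succ_lt hk) j⟩)
  · obtain ⟨r, hr⟩ := hθ.norm.bddAbove_range
    have hb : ∀ r : ℝ, ∃ C : ℝ, ∀ (_ : Unit) (y : ℝ), |y| ≤ r → |g y| ≤ C ∧ |a y| ≤ C := by
      intro r
      obtain ⟨B, hB⟩ := exists_bound_of_continuous hg hg r
      obtain ⟨C, hC⟩ := ha r
      exact ⟨max B C, fun _ y hy => ⟨(hB () y hy).1.trans (le_max_left _ _),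
        (hC y hy).trans (le_max_right _ _)⟩⟩
    obtain ⟨C, -, hC⟩ := exists_bound_dLoss hμ hH hgrowth hb r
    exact ⟨C, fun n p hp => hC () (θs n) (hr ⟨n, rfl⟩) p hp⟩

end Limits

section Subgradients

variable {n : ℕ} {f : EuclideanSpace ℝ (Fin n) → ℝ} {v x : EuclideanSpace ℝ (Fin n)}

theorem mem_frechetSubgradients_of_hasGradientAt (h : HasGradientAt f v x) :
    v ∈ frechetSubgradients f x := by
  have ht : Tendsto (fun h : EuclideanSpace ℝ (Fin n) =>
      (f (x + h) - f x - inner ℝ v h) / ‖h‖) (𝓝[≠] 0) (𝓝 0) := by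
    have := (hasGradientAt_iff_isLittleO_nhds_zero.1 h).norm_right.tendsto_div_nhds_zero
    exact this.mono_left nhdsWithin_le_nhds
  change (0 : EReal) ≤ liminf _ _
  refine le_of_forall_lt fun c hc => ?_
  obtain ⟨b, hcb, hb⟩ := EReal.lt_iff_exists_real_btwn.1 hc
  refine hcb.trans_le (le_liminf_of_le (by isBoundedDefault) ?_)
  filter_upwards [ht.eventually (lt_mem_nhds (EReal.coe_lt_coe_iff.1 hb))] with y hy
  exact EReal.coe_le_coe_iff.2 hy.le

theorem mem_limitingSubgradients_of_tendsto {vs xs : ℕ → EuclideanSpace ℝ (Fin n)}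
    (h : ∀ m, HasGradientAt f (vs m) (xs m)) (hx : Tendsto xs atTop (𝓝 x))
    (hv : Tendsto vs atTop (𝓝 v)) : v ∈ limitingSubgradients f x := by
  refine Set.mem_iInter₂.2 fun ε hε => mem_closure_of_tendsto hv ?_
  filter_upwards [(hx.const_sub x).norm.eventually (gt_mem_nhds (by simpa using hε))] with m hm
  exact Set.mem_biUnion hm (mem_frechetSubgradients_of_hasGradientAt (h m))

theorem hasGradientAt_of_tendsto {U : Set (EuclideanSpace ℝ (Fin n))} (hU : IsOpen U)
    (hf : ContDiffOn ℝ 1 f U) (hxU : x ∈ U) {vs xs : ℕ → EuclideanSpace ℝ (Fin n)}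
    (h : ∀ m, HasGradientAt f (vs m) (xs m)) (hx : Tendsto xs atTop (𝓝 x))
    (hv : Tendsto vs atTop (𝓝 v)) : HasGradientAt f v x := by
  have hd : DifferentiableAt ℝ f x :=
    (hf.differentiableOn one_ne_zero).differentiableAt (hU.mem_nhds hxU)
  have hc : ContinuousAt (fderiv ℝ f) x :=
    (hf.continuousOn_fderiv_of_isOpen hU le_rfl).continuousAt (hU.mem_nhds hxU)
  have h1 : Tendsto (fun m => InnerProductSpace.toDual ℝ _ (vs m)) atTop (𝓝 (fderiv ℝ f x)) :=
    (hc.tendsto.comp hx).congr fun m => (h m).hasFDerivAt.fderiv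
  have h2 := ((InnerProductSpace.toDual ℝ (EuclideanSpace ℝ (Fin n))).continuous.tendsto v).comp hv
  rw [hasGradientAt_iff_hasFDerivAt, tendsto_nhds_unique h2 h1]
  exact hd.hasFDerivAt

end Subgradients

end DeepANN

theorem theoremX (L : ℕ) (hL : 0 < L) (ℓ : ℕ → ℕ) (hℓ : ∀ k ≤ L, 0 < ℓ k)
    (μ : Measure (DeepANN.Layer ℓ 0 × DeepANN.Layer ℓ L)) [IsFiniteMeasure μ]
    (hμ : Bornology.IsBounded {x | ∃ y, (x, y) ∈ μ.support})
    (H : DeepANN.Layer ℓ L × DeepANN.Layer ℓ L × DeepANN.Param ℓ L → ℝ)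
    (hH : ContDiff ℝ 1 H)
    (hint : ∀ A : ℝ → ℝ, Continuous A → ∀ θ : DeepANN.Param ℓ L,
      Integrable (DeepANN.lossAt ℓ L H A θ) μ)
    (hgrowth : DeepANN.GradGrowth ℓ L H μ)
    (S : Finset ℝ) (g : ℝ → ℝ) (hg : Continuous g) (hgS : ContDiffOn ℝ 1 g (↑S : Set ℝ)ᶜ)
    (a : ℝ → ℝ) (ha : ∀ x ∉ S, a x = deriv g x)
    (hosc : min (DeepANN.oneSidedOsc a S (-1)) (DeepANN.oneSidedOsc a S 1) = 0)
    (z : ℕ)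
    (hbdd : ∀ m : ℕ, ∃ C : ℝ, ∀ x ∈ Set.Icc (-(m : ℝ)) m,
      |a x| * DeepANN.boundWeight z μ ≤ C) :
    (∀ A : ℝ → ℝ, ContDiff ℝ 1 A → ContDiff ℝ 1 (DeepANN.risk ℓ L H μ A)) ∧
    (∃! G : DeepANN.Param ℓ L → DeepANN.Param ℓ L,
      DeepANN.IsGenGradient ℓ L H μ g a (DeepANN.boundWeight z μ) G) ∧
    (∀ G : DeepANN.Param ℓ L → DeepANN.Param ℓ L,
      DeepANN.IsGenGradient ℓ L H μ g a (DeepANN.boundWeight z μ) G →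
      (∀ θ, G θ ∈ DeepANN.limitingSubgradients (DeepANN.risk ℓ L H μ g) θ) ∧
      (∀ U : Set (DeepANN.Param ℓ L), IsOpen U → ContDiffOn ℝ 1 (DeepANN.risk ℓ L H μ g) U →
        ∀ θ ∈ U, HasGradientAt (DeepANN.risk ℓ L H μ g) (G θ) θ)) := by
  open DeepANN in
  obtain ⟨σ, hσ, hσosc⟩ : ∃ σ : ℝ, |σ| = 1 ∧ oneSidedOsc a S σ = 0 := by
    rcases min_choice (oneSidedOsc a S (-1)) (oneSidedOsc a S 1) with h | h
    · exact ⟨-1, by simp, h ▸ hosc⟩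
    · exact ⟨1, by simp, h ▸ hosc⟩
  have hσ0 : σ ≠ 0 := by
    rintro rfl
    simp at hσ
  have hopen : IsOpen (↑S : Set ℝ)ᶜ := S.finite_toSet.isClosed.isOpen_compl
  have hd : ∀ x ∉ S, HasDerivAt g (a x) x := fun x hx => by
    rw [ha x hx]
    exact ((hgS.differentiableOn one_ne_zero).differentiableAt (hopen.mem_nhds hx)).hasDerivAt
  have hc : ∀ x ∉ S, ContinuousAt a x := fun x hx =>
    ((hgS.continuousOn_deriv_of_isOpen hopen le_rfl).continuousAt (hopen.mem_nhds hx)).congr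
      (eventually_of_mem (hopen.mem_nhds hx) fun y hy => (ha y hy).symm)
  have hs : ∀ x, ContinuousWithinAt a {y | 0 < σ * (y - x)} x := fun x => by
    by_cases hx : x ∈ S
    · exact continuousWithinAt_of_oneSidedOsc_eq_zero hσ hσosc hx
    · exact (hc x hx).continuousWithinAt
  set w := boundWeight z μ
  have hw0 : 0 ≤ w := boundWeight_nonneg z μ
  have hab : w ≠ 0 → ∀ r : ℝ, ∃ C : ℝ, ∀ x, |x| ≤ r → |a x| ≤ C := fun hw r => by
    obtain ⟨C, hC⟩ := hbdd ⌈r⌉₊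
    exact ⟨C / w, fun x hx => (le_div_iff₀ (hw0.lt_of_ne' hw)).2
      (hC x (abs_le.1 (hx.trans (Nat.le_ceil r))))⟩
  have hw : μ.support.Finite ∨ 0 < w := by
    rcases hw0.eq_or_lt with h | h
    · exact Or.inl (finite_support_of_boundWeight_eq_zero h.symm)
    · exact Or.inr h
  obtain ⟨A, hA⟩ := exists_isApprox hσ0 hg hd hc (fun s _ => hs s) hw0 hab
  let G₀ : Param ℓ L → Param ℓ L := fun θ =>
    (InnerProductSpace.toDual ℝ _).symm (∫ p, dLoss ℓ L H g a θ p ∂μ)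
  have hlim : ∀ (θ : Param ℓ L) (B : ℕ → ℝ → ℝ), IsApprox g a w B →
      Tendsto (fun n => ∇ (risk ℓ L H μ (B n)) θ) atTop (𝓝 (G₀ θ)) := fun θ B hB => by
    have h := hB.tendsto_integral_dLoss hL hμ hH hint hgrowth hw θ
    refine (((InnerProductSpace.toDual ℝ (Param ℓ L)).symm.continuous.tendsto _).comp h).congr
      fun n => ?_
    rw [gradient, (hasFDerivAt_risk_of_contDiff hL hμ hH hint hgrowth (hB.contDiff n) θ).fderiv]
    rfl
  have huniq : ∀ G : Param ℓ L → Param ℓ L, IsGenGradient ℓ L H μ g a w G → G = G₀ :=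
    fun G hG => funext fun θ =>
      tendsto_nhds_unique (tendsto_iff_norm_sub_tendsto_zero.2 (hG θ A hA)) (hlim θ A hA)
  refine ⟨fun B hB => contDiff_risk hL hμ hH hint hgrowth hB,
    ⟨G₀, fun θ B hB => tendsto_iff_norm_sub_tendsto_zero.1 (hlim θ B hB), huniq⟩, ?_⟩
  intro G hG
  obtain rfl := huniq G hG
  have hseq : ∀ θ : Param ℓ L, ∃ θs : ℕ → Param ℓ L, Tendsto θs atTop (𝓝 θ) ∧
      (∀ n, HasGradientAt (risk ℓ L H μ g) (G₀ (θs n)) (θs n)) ∧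
      Tendsto (fun n => G₀ (θs n)) atTop (𝓝 (G₀ θ)) := fun θ => by
    obtain ⟨θs, hθs, hgen, hlt⟩ := exists_seq_generic hμ hg S hσ θ
    refine ⟨θs, hθs, fun n => ?_, ?_⟩
    · exact hasFDerivAt_iff_hasGradientAt.1
        (hasFDerivAt_risk_of_generic hA hL hμ hH hint hgrowth hw hg hd (hgen n))
    · exact ((InnerProductSpace.toDual ℝ (Param ℓ L)).symm.continuous.tendsto _).comp
        (tendsto_integral_dLoss_of_lt hA hL hμ hH hint hgrowth hg
          (hw.imp_right fun h => hab h.ne') hs hθs hlt)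
  refine ⟨fun θ => ?_, fun U hU hf θ hθU => ?_⟩
  · obtain ⟨θs, hθs, hgrad, hG'⟩ := hseq θ
    exact mem_limitingSubgradients_of_tendsto hgrad hθs hG'
  · obtain ⟨θs, hθs, hgrad, hG'⟩ := hseq θ
    exact hasGradientAt_of_tendsto hU hf hθU hgrad hθs hG'
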